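/- Consider an episodic Markov decision process with state space $\mathcal S$, action space $\mathcal A$, transition model $P$, reward $r:\mathcal S\times\mathcal A\to[-R,R]$ ($R>0$), discount factor $\gamma\in(0,1)$, initial distribution $\rho$ and finite horizon $H\ge 1$, and a family of policies $\pi_\theta$, $\theta\in\mathbb R^d$, with strictly positive densities $\pi_\theta(a\,|\,s)$. Let $p(\cdot\,|\,\theta)$ be the law of the trajectory $\tau=(s_h,a_h)_{h<H}$ under $\pi_\theta$, let $V(\theta)=\mathbb E_{\tau\sim p(\cdot|\theta)}\big[\sum_{h<H}\gamma^h r(s_h,a_h)\big]$, and put $$g(\tau\,|\,\theta)=\sum_{h<H}\gamma^h r(s_h,a_h)\sum_{z\le h}\nabla_\theta\log\pi_\theta(a_z|s_z),\qquad g^{\omega_{\theta_2}}(\tau\,|\,\theta_1)=\sum_{h<H}\Big(\prod_{j\le h}\tfrac{\pi_{\theta_1}(a_j|s_j)}{\pi_{\theta_2}(a_j|s_j)}\Big)\gamma^h r(s_h,a_h)\sum_{z\le h}\nabla_\theta\log\pi_{\theta_1}(a_z|s_z).$$ Assume that $\theta\mapsto\pi_\theta(a|s)$ is twice differentiable and that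 there are constants $G,M,\sigma,W>0$ such that for all $s,a,\theta,\theta_a,\theta_b$: $\|\nabla_\theta\log\pi_\theta(a|s)\|\le G$; $\|\nabla^2_\theta\log\pi_\theta(a|s)\|\le M$; $\mathrm{Var}_{\tau\sim p(\cdot|\theta)}(g(\tau|\theta))\le\sigma^2$; and $\mathrm{Var}_{\tau\sim p(\cdot|\theta_b)}\big(\prod_{j<H}\pi_{\theta_a}(a_j|s_j)/\pi_{\theta_b}(a_j|s_j)\big)\le W$. Let $$L=\tfrac{MR}{(1-\gamma)^2}+\tfrac{2G^2R}{(1-\gamma)^3},\qquad C_\omega=\tfrac{24RG^2(2G^2+M)(W+1)\gamma}{(1-\gamma)^5},\qquad C=2(L^2+C_\omega).$$ PAGE-PG with initial parameter $\theta_0$, batch sizes $N,B\ge1$, step size $\eta$ and switching probability $p$ samples $N$ independent trajectories $\tau_i\sim p(\cdot|\theta_0)$ and sets $v_0=\frac1N\sum_{i=1}^N g(\tau_i|\theta_0)$; at each iteration $t=0,1,\dots$ it sets $\theta_{t+1}=\theta_t+\eta v_t$ and then, with probability $p$, samples $N$ independent trajectories $\tau_i\sim p(\cdot|\theta_{t+1})$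 and sets $v_{t+1}=\frac1N\sum_{i=1}^N g(\tau_i|\theta_{t+1})$, or, with probability $1-p$, samples $B$ independent trajectories $\tau_i\sim p(\cdot|\theta_{t+1})$ and sets $v_{t+1}=\frac1B\sum_{i=1}^B g(\tau_i|\theta_{t+1})+v_t-\frac1B\sum_{i=1}^B g^{\omega_{\theta_{t+1}}}(\tau_i|\theta_t)$. For $\epsilon>0$ choose $N=N(\epsilon)$, $B=B(\epsilon)\ge1$, $\eta=\sqrt B/\sqrt{2CN}$ and $p=1/N$, where, as $\epsilon\to0$, $B=\mathcal O(1)$, $N=\mathcal O(\epsilon^{-2})$, and $N\ge\kappa\epsilon^{-2}$ for some constant $\kappa>\sigma^2$. Then $V$ is differentiable and there are numbers of iterations $T_0(\epsilon)\ge1$ such that, for all sufficiently small $\epsilon>0$, $$\frac1T\sum_{t=0}^{T-1}\mathbb E\big[\|\nabla_\theta V(\theta_t)\|^2\big]\le\epsilon^2\qquad\text{for all }T\ge T_0(\epsilon),$$ and the expected total number of trajectories sampled in the initialization and the first $T_0(\epsilon)$ iterations is $\mathcal O(\epsilon^{-3})$ as $\epsilon\to0$. -/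

import Mathlib

open MeasureTheory ProbabilityTheory Filter Topology Asymptotics

noncomputable section

/-- An episodic Markov decision process with general measurable state and action spaces: transition
model `trans`, bounded reward with values in `[-R, R]`, discount factor `γ ∈ (0, 1)`, initial state
distribution `init` and finite horizon `H > 0`. -/
structure EpisodicMDP (S A : Type*) [MeasurableSpace S] [MeasurableSpace A] where
  /-- `trans (s, a)` is the distribution of the next state. -/
  trans : Kernel (S × A) S
  isMarkovKernel_trans : IsMarkovKernel trans
  /-- The initial state distribution. -/
  init : Measure S
  isProbabilityMeasure_init : IsProbabilityMeasure init
  reward : S → A → ℝ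
  measurable_reward : Measurable (Function.uncurry reward)
  R : ℝ
  R_pos : 0 < R
  abs_reward_le : ∀ s a, |reward s a| ≤ R
  γ : ℝ
  γ_pos : 0 < γ
  γ_lt_one : γ < 1
  /-- The horizon. -/
  H : ℕ
  H_pos : 0 < H

attribute [instance] EpisodicMDP.isMarkovKernel_trans EpisodicMDP.isProbabilityMeasure_init

/-- A parametrized family of stochastic stationary policies: for a parameter `θ ∈ ℝᵈ` and a state
`s`, `dens θ s` is a strictly positive probability density on the action space with respect to the
reference measure `ν` (counting measure for discrete actions, Lebesgue measure for continuous
ones). -/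
structure PolicyFamily (d : ℕ) (S : Type*) {A : Type*} [MeasurableSpace S] [MeasurableSpace A]
    (ν : Measure A) where
  dens : EuclideanSpace ℝ (Fin d) → S → A → ℝ
  measurable_dens :
    Measurable fun z : EuclideanSpace ℝ (Fin d) × S × A => dens z.1 z.2.1 z.2.2
  dens_pos : ∀ θ s a, 0 < dens θ s a
  lintegral_dens : ∀ θ s, ∫⁻ a, ENNReal.ofReal (dens θ s a) ∂ν = 1

/-- A trajectory `(s₀, a₀), …, (s_{H-1}, a_{H-1})`. -/
abbrev Trajectory (H : ℕ) (S A : Type*) := Fin H → S × A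

namespace PolicyFamily

variable {d : ℕ} {S A : Type*} [MeasurableSpace S] [MeasurableSpace A] {ν : Measure A}

/-- The score `∇_θ log π_θ(a | s)`. -/
def score (π : PolicyFamily d S ν) (θ : EuclideanSpace ℝ (Fin d)) (s : S) (a : A) :
    EuclideanSpace ℝ (Fin d) :=
  gradient (fun ϑ => Real.log (π.dens ϑ s a)) θ

/-- The policy `π_θ` as a kernel from states to actions. -/
def actionKernel [SFinite ν] (π : PolicyFamily d S ν) (θ : EuclideanSpace ℝ (Fin d)) :
    Kernel S A :=
  Kernel.withDensity (Kernel.const S ν) fun s a => ENNReal.ofReal (π.dens θ s a)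

instance [SFinite ν] (π : PolicyFamily d S ν) (θ : EuclideanSpace ℝ (Fin d)) :
    IsMarkovKernel (π.actionKernel θ) := by
  have h : Measurable (Function.uncurry fun s a => ENNReal.ofReal (π.dens θ s a)) :=
    (π.measurable_dens.comp (measurable_const.prodMk measurable_id)).ennreal_ofReal
  refine ⟨fun s => ⟨?_⟩⟩
  rw [actionKernel, Kernel.withDensity_apply' _ h]
  simpa using π.lintegral_dens θ s

/-- The truncated importance weight `ω_{0:h}(τ | θ₂, θ₁) = ∏_{j ≤ h} π_{θ₁}(a_j|s_j)/π_{θ₂}(a_j|s_j)`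
of a trajectory sampled with `θ₂`. -/
def weightUpTo (π : PolicyFamily d S ν) {H : ℕ} (θ₂ θ₁ : EuclideanSpace ℝ (Fin d)) (h : Fin H)
    (τ : Trajectory H S A) : ℝ :=
  ∏ j ∈ Finset.Iic h, π.dens θ₁ (τ j).1 (τ j).2 / π.dens θ₂ (τ j).1 (τ j).2

/-- The full importance weight `ω(τ | θ₂, θ₁) = p(τ | θ₁) / p(τ | θ₂)`, in which the initial
distribution and the transition model cancel. -/
def weight (π : PolicyFamily d S ν) {H : ℕ} (θ₂ θ₁ : EuclideanSpace ℝ (Fin d))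
    (τ : Trajectory H S A) : ℝ :=
  ∏ j, π.dens θ₁ (τ j).1 (τ j).2 / π.dens θ₂ (τ j).1 (τ j).2

end PolicyFamily

namespace EpisodicMDP

variable {d : ℕ} {S A : Type*} [MeasurableSpace S] [MeasurableSpace A] {ν : Measure A}

/-- The joint law of the first `n` state-action pairs and of the state `s_n`, where `s₀ ∼ init`,
`a_h ∼ π_θ(· | s_h)` and `s_{h+1} ∼ trans(s_h, a_h)`. -/
def prefixLaw [SFinite ν] (m : EpisodicMDP S A) (π : PolicyFamily d S ν)
    (θ : EuclideanSpace ℝ (Fin d)) : (n : ℕ) → Measure ((Fin n → S × A) × S)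
  | 0 => m.init.map fun s => (Fin.elim0, s)
  | n + 1 =>
    ((prefixLaw m π θ n ⊗ₘ (π.actionKernel θ).comap Prod.snd measurable_snd) ⊗ₘ
        m.trans.comap (fun z : ((Fin n → S × A) × S) × A => (z.1.2, z.2))
          (by fun_prop)).map
      fun z => (Fin.snoc (α := fun _ => S × A) z.1.1.1 (z.1.1.2, z.1.2), z.2)

/-- The trajectory distribution `p(· | θ)`. -/
def trajLaw [SFinite ν] (m : EpisodicMDP S A) (π : PolicyFamily d S ν)
    (θ : EuclideanSpace ℝ (Fin d)) : Measure (Trajectory m.H S A) :=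
  (m.prefixLaw π θ m.H).map Prod.fst

instance [SFinite ν] (m : EpisodicMDP S A) (π : PolicyFamily d S ν)
    (θ : EuclideanSpace ℝ (Fin d)) (n : ℕ) : IsProbabilityMeasure (m.prefixLaw π θ n) := by
  induction n with
  | zero => exact Measure.isProbabilityMeasure_map (by fun_prop)
  | succ n ih =>
    refine Measure.isProbabilityMeasure_map (Measurable.aemeasurable ?_)
    refine Measurable.prodMk ?_ measurable_snd
    refine measurable_pi_lambda _ fun i => ?_
    refine Fin.lastCases ?_ (fun j => ?_) i
    · simp only [Fin.snoc_last]
      fun_prop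
    · simp only [Fin.snoc_castSucc]
      fun_prop

instance [SFinite ν] (m : EpisodicMDP S A) (π : PolicyFamily d S ν)
    (θ : EuclideanSpace ℝ (Fin d)) : IsProbabilityMeasure (m.trajLaw π θ) :=
  Measure.isProbabilityMeasure_map measurable_fst.aemeasurable

/-- The discounted cumulative reward of a trajectory. -/
def discountedReward (m : EpisodicMDP S A) (τ : Trajectory m.H S A) : ℝ :=
  ∑ h : Fin m.H, m.γ ^ (h : ℕ) * m.reward (τ h).1 (τ h).2

/-- The objective `V(θ) = 𝔼_{τ ∼ p(· | θ)} [∑_h γ^h r(s_h, a_h)]`. -/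
def value [SFinite ν] (m : EpisodicMDP S A) (π : PolicyFamily d S ν)
    (θ : EuclideanSpace ℝ (Fin d)) : ℝ :=
  ∫ τ, m.discountedReward τ ∂(m.trajLaw π θ)

/-- The GPOMDP estimator
`g(τ | θ) = ∑_h γ^h r(s_h, a_h) ∑_{z ≤ h} ∇_θ log π_θ(a_z | s_z)`. -/
def gpomdp (m : EpisodicMDP S A) (π : PolicyFamily d S ν) (θ : EuclideanSpace ℝ (Fin d))
    (τ : Trajectory m.H S A) : EuclideanSpace ℝ (Fin d) :=
  ∑ h : Fin m.H, (m.γ ^ (h : ℕ) * m.reward (τ h).1 (τ h).2) •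
    ∑ z ∈ Finset.Iic h, π.score θ (τ z).1 (τ z).2

/-- The off-policy GPOMDP estimator
`g^{ω_{θ₂}}(τ | θ₁) = ∑_h ω_{0:h}(τ | θ₂, θ₁) γ^h r(s_h, a_h) ∑_{z ≤ h} ∇_θ log π_{θ₁}(a_z | s_z)`
of the gradient at `θ₁`, for a trajectory sampled with `θ₂`. -/
def gpomdpOff (m : EpisodicMDP S A) (π : PolicyFamily d S ν) (θ₂ θ₁ : EuclideanSpace ℝ (Fin d))
    (τ : Trajectory m.H S A) : EuclideanSpace ℝ (Fin d) :=
  ∑ h : Fin m.H, (π.weightUpTo θ₂ θ₁ h τ * (m.γ ^ (h : ℕ) * m.reward (τ h).1 (τ h).2)) •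
    ∑ z ∈ Finset.Iic h, π.score θ₁ (τ z).1 (τ z).2

end EpisodicMDP

/-! ### The assumptions -/

namespace PolicyFamily

variable {d : ℕ} {S A : Type*} [MeasurableSpace S] [MeasurableSpace A] {ν : Measure A}

/-- Bounded log-policy gradient. -/
def BoundedScore (π : PolicyFamily d S ν) (G : ℝ) : Prop :=
  ∀ s a θ, ‖π.score θ s a‖ ≤ G

/-- The policy is twice differentiable in the parameter, with bounded log-policy Hessian. -/
def SmoothPolicy (π : PolicyFamily d S ν) (M : ℝ) : Prop :=
  ∀ s a, Differentiable ℝ (fun θ => π.dens θ s a) ∧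
    Differentiable ℝ (fderiv ℝ fun θ => π.dens θ s a) ∧
    ∀ θ, ‖fderiv ℝ (fun ϑ => π.score ϑ s a) θ‖ ≤ M

end PolicyFamily

namespace EpisodicMDP

variable {d : ℕ} {S A : Type*} [MeasurableSpace S] [MeasurableSpace A] {ν : Measure A}

/-- `Var(g(τ | θ)) ≤ σ²` for all `θ`, with `τ ∼ p(· | θ)`. -/
def FiniteVariance [SFinite ν] (m : EpisodicMDP S A) (π : PolicyFamily d S ν) (σ : ℝ) : Prop :=
  ∀ θ, ∫⁻ τ, ‖m.gpomdp π θ τ - ∫ τ', m.gpomdp π θ τ' ∂(m.trajLaw π θ)‖ₑ ^ 2 ∂(m.trajLaw π θ)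
    ≤ ENNReal.ofReal (σ ^ 2)

/-- `Var(ω(τ | θ_b, θ_a)) ≤ W` for all `θ_a, θ_b`, with `τ ∼ p(· | θ_b)`. -/
def FiniteWeightVariance [SFinite ν] (m : EpisodicMDP S A) (π : PolicyFamily d S ν) (W : ℝ) :
    Prop :=
  ∀ θa θb, evariance (π.weight θb θa) (m.trajLaw π θb) ≤ ENNReal.ofReal W

/-- `L = M R / (1 - γ)² + 2 G² R / (1 - γ)³`. -/
def constL (m : EpisodicMDP S A) (G M : ℝ) : ℝ :=
  M * m.R / (1 - m.γ) ^ 2 + 2 * G ^ 2 * m.R / (1 - m.γ) ^ 3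

/-- `C_ω = 24 R G² (2 G² + M) (W + 1) γ / (1 - γ)⁵`. -/
def constCω (m : EpisodicMDP S A) (G M W : ℝ) : ℝ :=
  24 * m.R * G ^ 2 * (2 * G ^ 2 + M) * (W + 1) * m.γ / (1 - m.γ) ^ 5

/-- `C = 2 (L² + C_ω)`. -/
def constC (m : EpisodicMDP S A) (G M W : ℝ) : ℝ :=
  2 * (m.constL G M ^ 2 + m.constCω G M W)

end EpisodicMDP

/-! ### The algorithm -/

/-- The state of PAGE-PG: current iterate `θ_t`, current gradient estimate `v_t`, and the total
number of trajectories sampled so far. -/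
abbrev PageState (d : ℕ) := EuclideanSpace ℝ (Fin d) × EuclideanSpace ℝ (Fin d) × ℕ

/-- The input of PAGE-PG: initial parameter, large and small batch size, step size, and switching
probability. -/
structure PageInput (d : ℕ) where
  θ₀ : EuclideanSpace ℝ (Fin d)
  N : ℕ
  B : ℕ
  η : ℝ
  p : ℝ

namespace EpisodicMDP

variable {d : ℕ} {S A : Type*} [MeasurableSpace S] [MeasurableSpace A] {ν : Measure A}

/-- Law of the state after the initialization `v₀ = (1/N) ∑ g(τ_i | θ₀)`. -/
def pageInit [SFinite ν] (m : EpisodicMDP S A) (π : PolicyFamily d S ν) (I : PageInput d) :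
    Measure (PageState d) :=
  (Measure.pi fun _ : Fin I.N => m.trajLaw π I.θ₀).map fun τ =>
    (I.θ₀, (I.N : ℝ)⁻¹ • ∑ i, m.gpomdp π I.θ₀ (τ i), I.N)

/-- Law of the next state given the state `x = (θ_t, v_t, n)`. With `θ_{t+1} = θ_t + η v_t`, the new
estimate is, with probability `p`, the large-batch one (using `N` independent trajectories from
`p(· | θ_{t+1})`), and, with probability `1 - p`, the small-batch correction of `v_t` (using `B`
independent trajectories from `p(· | θ_{t+1})`). -/
def pageStep [SFinite ν] (m : EpisodicMDP S A) (π : PolicyFamily d S ν) (I : PageInput d)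
    (x : PageState d) : Measure (PageState d) :=
  let θ := x.1
  let v := x.2.1
  let n := x.2.2
  let θ' := θ + I.η • v
  ENNReal.ofReal I.p •
      (Measure.pi fun _ : Fin I.N => m.trajLaw π θ').map (fun τ =>
        (θ', (I.N : ℝ)⁻¹ • ∑ i, m.gpomdp π θ' (τ i), n + I.N)) +
    ENNReal.ofReal (1 - I.p) •
      (Measure.pi fun _ : Fin I.B => m.trajLaw π θ').map (fun τ =>
        (θ', (I.B : ℝ)⁻¹ • ∑ i, m.gpomdp π θ' (τ i) + v
            - (I.B : ℝ)⁻¹ • ∑ i, m.gpomdpOff π θ' θ (τ i), n + I.B))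

/-- Law of the state `(θ_t, v_t, number of trajectories sampled so far)` after `t` iterations. -/
def pageLaw [SFinite ν] (m : EpisodicMDP S A) (π : PolicyFamily d S ν) (I : PageInput d) :
    ℕ → Measure (PageState d)
  | 0 => m.pageInit π I
  | t + 1 => (pageLaw m π I t).bind (m.pageStep π I)

/-- `(1/T) ∑_{t < T} 𝔼 ‖∇V(θ_t)‖²`. -/
def pageAvgGradSq [SFinite ν] (m : EpisodicMDP S A) (π : PolicyFamily d S ν) (I : PageInput d)
    (T : ℕ) : ℝ :=
  (1 / (T : ℝ)) * ∑ t ∈ Finset.range T, ∫ x, ‖gradient (m.value π) x.1‖ ^ 2 ∂(m.pageLaw π I t)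

/-- Expected total number of trajectories sampled during the initialization and the first `T`
iterations. -/
def pageExpectedTrajectories [SFinite ν] (m : EpisodicMDP S A) (π : PolicyFamily d S ν)
    (I : PageInput d) (T : ℕ) : ℝ :=
  ∫ x, (x.2.2 : ℝ) ∂(m.pageLaw π I T)

/-- The input prescribed by the complexity result: `η = √B / √(2 C N)` and `p = 1 / N`. -/
def pageTunedInput (m : EpisodicMDP S A) (G M W : ℝ) (θ₀ : EuclideanSpace ℝ (Fin d)) (N B : ℕ) :
    PageInput d where
  θ₀ := θ₀
  N := N
  B := B
  η := √(B : ℝ) / √(2 * m.constC G M W * N)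
  p := 1 / (N : ℝ)

end EpisodicMDP

end

/-! ### Change of measure between the trajectory laws -/

section ChangeOfMeasure

variable {d : ℕ} {S A : Type*} [MeasurableSpace S] [MeasurableSpace A] {ν : Measure A}

/-! The proof is a one-step Lyapunov argument for `lyapunov`, the optimality gap plus `η N / 2`
times the squared estimation error `‖v - ∇V(θ)‖²`, with the error capped at `a²`, `a = 1 / (8 H G
η)`. With `p = 1 / N` and `K = H² R G`, a deterministic bound on `‖∇V‖`, there are two regimes.

If the error is below the cap, then `η ‖v‖ ≤ η a + η K ≤ 1 / (4 H G)`. A log-density moves by at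
most `G` times the length of a step, so every importance weight of that step is at most `exp (H G
‖step‖)`, whose square is at most 2. Hence `g - g^ω` is bounded by `√2 L ‖step‖` on each trajectory
(`norm_gpomdpOff_sub_le`), and the same estimate makes `∇V` Lipschitz along the step. The small
batch adds at most `2 L² ‖step‖² / B` to the mean squared error, the large batch replaces the error
by at most `σ² / N`, and the descent lemma together with polarization leaves an expected gain of
`η/2 ‖∇V‖²`, up to `η/2 · σ² / N`.

If the error reaches the cap, nothing is known about the step, but nothing is needed: the value
changes by at most `2 H R`, a small batch cannot push the capped error above `a²`, and the large
batch, taken with probability `1 / N`, lowers the potential by about `η a² / 2` on average. This is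
of order `1 / η`, so for small `η` it pays for everything.

Telescoping gives an average squared gradient of at most `σ² / N + (4 H R / η + σ²) / T`. Here `1 /
η = O(ε⁻¹)`, and `N ≥ κ ε⁻²` with `κ > σ²` leaves a fixed fraction of `ε²` for the second term, so
`T` of order `ε⁻³` suffices. An iteration costs on average at most `p N + B = 1 + B = O(1)`
trajectories.

The analytic input is the policy gradient theorem `hasGradientAt_value`, whose off-policy form rests
on the change of measure between trajectory laws. -/

theorem measurable_finSnoc {X : Type*} [MeasurableSpace X] (n : ℕ) :
    Measurable fun z : (Fin n → X) × X => (Fin.snoc (α := fun _ => X) z.1 z.2 : Fin (n + 1) → X) := by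
  refine measurable_pi_lambda _ fun i => ?_
  refine Fin.lastCases ?_ (fun j => ?_) i
  · simp only [Fin.snoc_last]
    fun_prop
  · simp only [Fin.snoc_castSucc]
    fun_prop

namespace PolicyFamily

theorem measurable_dens_right (π : PolicyFamily d S ν) (θ : EuclideanSpace ℝ (Fin d)) :
    Measurable fun x : S × A => π.dens θ x.1 x.2 :=
  π.measurable_dens.comp (measurable_const.prodMk measurable_id)

theorem lintegral_actionKernel [SFinite ν] (π : PolicyFamily d S ν)
    (θ : EuclideanSpace ℝ (Fin d)) (s : S) {f : A → ENNReal} (hf : Measurable f) :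
    ∫⁻ a, f a ∂(π.actionKernel θ s) = ∫⁻ a, ENNReal.ofReal (π.dens θ s a) * f a ∂ν := by
  rw [actionKernel, Kernel.lintegral_withDensity _ _ _ hf, Kernel.const_apply]
  exact (π.measurable_dens_right θ).ennreal_ofReal

theorem ratio_pos (π : PolicyFamily d S ν) (θ₂ θ₁ : EuclideanSpace ℝ (Fin d)) (x : S × A) :
    0 < π.dens θ₁ x.1 x.2 / π.dens θ₂ x.1 x.2 :=
  div_pos (π.dens_pos _ _ _) (π.dens_pos _ _ _)

theorem measurable_ratio (π : PolicyFamily d S ν) :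
    Measurable fun z : (EuclideanSpace ℝ (Fin d) × EuclideanSpace ℝ (Fin d)) × S × A =>
      π.dens z.1.2 z.2.1 z.2.2 / π.dens z.1.1 z.2.1 z.2.2 :=
  (π.measurable_dens.comp (by fun_prop : Measurable fun
      z : (EuclideanSpace ℝ (Fin d) × EuclideanSpace ℝ (Fin d)) × S × A => (z.1.2, z.2))).div
    (π.measurable_dens.comp (by fun_prop : Measurable fun
      z : (EuclideanSpace ℝ (Fin d) × EuclideanSpace ℝ (Fin d)) × S × A => (z.1.1, z.2)))

theorem weightUpTo_pos (π : PolicyFamily d S ν) {H : ℕ} (θ₂ θ₁ : EuclideanSpace ℝ (Fin d))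
    (h : Fin H) (τ : Trajectory H S A) : 0 < π.weightUpTo θ₂ θ₁ h τ :=
  Finset.prod_pos fun j _ => π.ratio_pos θ₂ θ₁ (τ j)

theorem weightUpTo_last (π : PolicyFamily d S ν) {n : ℕ} (θ₂ θ₁ : EuclideanSpace ℝ (Fin d))
    (τ : Trajectory (n + 1) S A) : π.weightUpTo θ₂ θ₁ (Fin.last n) τ = π.weight θ₂ θ₁ τ := by
  rw [weightUpTo, weight]
  congr 1
  ext j
  simp [Fin.le_last]

theorem weightUpTo_castSucc (π : PolicyFamily d S ν) {n : ℕ} (θ₂ θ₁ : EuclideanSpace ℝ (Fin d))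
    (h : Fin n) (τ : Trajectory (n + 1) S A) :
    π.weightUpTo θ₂ θ₁ h.castSucc τ = π.weightUpTo θ₂ θ₁ h fun j => τ j.castSucc := by
  rw [weightUpTo, weightUpTo, ← Fin.map_castSuccEmb_Iic, Finset.prod_map]
  rfl

theorem measurable_weightUpTo_joint (π : PolicyFamily d S ν) {H : ℕ} (h : Fin H) :
    Measurable fun z : (EuclideanSpace ℝ (Fin d) × EuclideanSpace ℝ (Fin d)) × Trajectory H S A =>
      π.weightUpTo z.1.1 z.1.2 h z.2 := by
  unfold weightUpTo
  refine Finset.measurable_prod _ fun j _ => ?_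
  exact π.measurable_ratio.comp (by fun_prop : Measurable fun
    z : (EuclideanSpace ℝ (Fin d) × EuclideanSpace ℝ (Fin d)) × Trajectory H S A => (z.1, z.2 j))

theorem measurable_weight_joint (π : PolicyFamily d S ν) {H : ℕ} :
    Measurable fun z : (EuclideanSpace ℝ (Fin d) × EuclideanSpace ℝ (Fin d)) × Trajectory H S A =>
      π.weight z.1.1 z.1.2 z.2 := by
  unfold weight
  refine Finset.measurable_prod _ fun j _ => ?_
  exact π.measurable_ratio.comp (by fun_prop : Measurable fun
    z : (EuclideanSpace ℝ (Fin d) × EuclideanSpace ℝ (Fin d)) × Trajectory H S A => (z.1, z.2 j))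

theorem measurable_weightUpTo (π : PolicyFamily d S ν) {H : ℕ} (θ₂ θ₁ : EuclideanSpace ℝ (Fin d))
    (h : Fin H) : Measurable fun τ : Trajectory H S A => π.weightUpTo θ₂ θ₁ h τ :=
  (π.measurable_weightUpTo_joint h).comp (measurable_prodMk_left (x := (θ₂, θ₁)))

theorem measurable_weight (π : PolicyFamily d S ν) {H : ℕ} (θ₂ θ₁ : EuclideanSpace ℝ (Fin d)) :
    Measurable fun τ : Trajectory H S A => π.weight θ₂ θ₁ τ :=
  π.measurable_weight_joint.comp (measurable_prodMk_left (x := (θ₂, θ₁)))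

theorem weight_snoc (π : PolicyFamily d S ν) {n : ℕ} (θ₂ θ₁ : EuclideanSpace ℝ (Fin d))
    (τ : Trajectory n S A) (x : S × A) :
    π.weight θ₂ θ₁ (Fin.snoc (α := fun _ => S × A) τ x : Trajectory (n + 1) S A) =
      π.weight θ₂ θ₁ τ * (π.dens θ₁ x.1 x.2 / π.dens θ₂ x.1 x.2) := by
  simp only [weight, Fin.prod_univ_castSucc, Fin.snoc_castSucc, Fin.snoc_last]

end PolicyFamily

namespace EpisodicMDP

theorem lintegral_prefixLaw_succ [SFinite ν] (m : EpisodicMDP S A) (π : PolicyFamily d S ν)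
    (θ : EuclideanSpace ℝ (Fin d)) (n : ℕ) {f : (Fin (n + 1) → S × A) × S → ENNReal}
    (hf : Measurable f) :
    ∫⁻ z, f z ∂(m.prefixLaw π θ (n + 1)) =
      ∫⁻ z, ∫⁻ a, ENNReal.ofReal (π.dens θ z.2 a) *
        ∫⁻ s', f (Fin.snoc (α := fun _ => S × A) z.1 (z.2, a), s') ∂(m.trans (z.2, a)) ∂ν
          ∂(m.prefixLaw π θ n) := by
  have hmap : Measurable fun z : (((Fin n → S × A) × S) × A) × S =>
      ((Fin.snoc (α := fun _ => S × A) z.1.1.1 (z.1.1.2, z.1.2) : Fin (n + 1) → S × A), z.2) :=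
    ((measurable_finSnoc n).comp (by fun_prop : Measurable fun
      z : (((Fin n → S × A) × S) × A) × S => (z.1.1.1, (z.1.1.2, z.1.2)))).prodMk measurable_snd
  have hf' : Measurable fun z : (((Fin n → S × A) × S) × A) × S =>
      f (Fin.snoc (α := fun _ => S × A) z.1.1.1 (z.1.1.2, z.1.2), z.2) := hf.comp hmap
  rw [prefixLaw, lintegral_map hf hmap, Measure.lintegral_compProd hf']
  have h2 : Measurable fun y : ((Fin n → S × A) × S) × A =>
      ∫⁻ s', f (Fin.snoc (α := fun _ => S × A) y.1.1 (y.1.2, y.2), s') ∂(m.trans (y.1.2, y.2)) := by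
    exact Measurable.lintegral_kernel_prod_right' (κ := m.trans.comap
      (fun z : ((Fin n → S × A) × S) × A => (z.1.2, z.2)) (by fun_prop)) hf'
  simp only [Kernel.comap_apply]
  rw [Measure.lintegral_compProd h2]
  refine lintegral_congr fun z => ?_
  rw [Kernel.comap_apply, π.lintegral_actionKernel]
  exact h2.comp measurable_prodMk_left

/-- Importance sampling for the law of the first `n` state-action pairs. -/
theorem lintegral_prefixLaw_eq_weight [SFinite ν] (m : EpisodicMDP S A) (π : PolicyFamily d S ν)
    (θ₂ θ₁ : EuclideanSpace ℝ (Fin d)) (n : ℕ) {f : (Fin n → S × A) × S → ENNReal}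
    (hf : Measurable f) :
    ∫⁻ z, f z ∂(m.prefixLaw π θ₁ n) =
      ∫⁻ z, ENNReal.ofReal (π.weight θ₂ θ₁ z.1) * f z ∂(m.prefixLaw π θ₂ n) := by
  induction n with
  | zero => simp [prefixLaw, PolicyFamily.weight]
  | succ n ih =>
    have hw : Measurable fun z : (Fin (n + 1) → S × A) × S =>
        ENNReal.ofReal (π.weight θ₂ θ₁ z.1) * f z :=
      ((π.measurable_weight θ₂ θ₁).comp measurable_fst).ennreal_ofReal.mul hf
    rw [lintegral_prefixLaw_succ m π θ₁ n hf, lintegral_prefixLaw_succ m π θ₂ n hw, ih]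
    · refine lintegral_congr fun z => ?_
      have hmz : Measurable fun a => ENNReal.ofReal (π.dens θ₁ z.2 a) *
          ∫⁻ s', f (Fin.snoc (α := fun _ => S × A) z.1 (z.2, a), s') ∂(m.trans (z.2, a)) := by
        refine Measurable.mul ?_ ?_
        · exact ((π.measurable_dens_right θ₁).comp measurable_prodMk_left).ennreal_ofReal
        · refine Measurable.lintegral_kernel_prod_right' (κ := m.trans.comap
            (fun a : A => (z.2, a)) (by fun_prop)) (f := fun y : A × S =>
              f (Fin.snoc (α := fun _ => S × A) z.1 (z.2, y.1), y.2)) ?_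
          exact hf.comp (((measurable_finSnoc n).comp (by fun_prop : Measurable fun
            y : A × S => (z.1, (z.2, y.1)))).prodMk measurable_snd)
      rw [← lintegral_const_mul _ hmz]
      refine lintegral_congr fun a => ?_
      have hfs : Measurable fun s' =>
          f ((Fin.snoc (α := fun _ => S × A) z.1 (z.2, a) : Fin (n + 1) → S × A), s') :=
        hf.comp measurable_prodMk_left
      simp only [π.weight_snoc]
      rw [lintegral_const_mul _ hfs, ← mul_assoc, ← mul_assoc]
      congr 1
      have h0 : 0 ≤ π.weight θ₂ θ₁ z.1 := Finset.prod_nonneg fun j _ => (π.ratio_pos θ₂ θ₁ _).le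
      rw [← ENNReal.ofReal_mul h0, ← ENNReal.ofReal_mul (π.dens_pos _ _ _).le]
      congr 1
      have := (π.dens_pos θ₂ z.2 a).ne'
      field_simp
    · refine Measurable.lintegral_prod_right' (f := fun y : ((Fin n → S × A) × S) × A =>
        ENNReal.ofReal (π.dens θ₁ y.1.2 y.2) * ∫⁻ s',
          f (Fin.snoc (α := fun _ => S × A) y.1.1 (y.1.2, y.2), s') ∂(m.trans (y.1.2, y.2))) ?_
      refine Measurable.mul ?_ ?_
      · exact ((π.measurable_dens_right θ₁).comp (by fun_prop : Measurable fun
          y : ((Fin n → S × A) × S) × A => (y.1.2, y.2))).ennreal_ofReal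
      · refine Measurable.lintegral_kernel_prod_right' (κ := m.trans.comap
          (fun y : ((Fin n → S × A) × S) × A => (y.1.2, y.2)) (by fun_prop))
            (f := fun y : (((Fin n → S × A) × S) × A) × S =>
              f (Fin.snoc (α := fun _ => S × A) y.1.1.1 (y.1.1.2, y.1.2), y.2)) ?_
        exact hf.comp (((measurable_finSnoc n).comp (by fun_prop : Measurable fun
          y : (((Fin n → S × A) × S) × A) × S =>
            (y.1.1.1, (y.1.1.2, y.1.2)))).prodMk measurable_snd)

/-- The marginal of the first `n` state-action pairs. -/
theorem lintegral_prefixLaw_succ_castSucc [SFinite ν] (m : EpisodicMDP S A)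
    (π : PolicyFamily d S ν) (θ : EuclideanSpace ℝ (Fin d)) (n : ℕ)
    {f : (Fin n → S × A) → ENNReal} (hf : Measurable f) :
    ∫⁻ z, f (fun j => z.1 j.castSucc) ∂(m.prefixLaw π θ (n + 1)) =
      ∫⁻ z, f z.1 ∂(m.prefixLaw π θ n) := by
  have hf' : Measurable fun z : (Fin (n + 1) → S × A) × S => f fun j => z.1 j.castSucc :=
    hf.comp (by fun_prop)
  rw [lintegral_prefixLaw_succ m π θ n hf']
  refine lintegral_congr fun z => ?_
  simp only [Fin.snoc_castSucc, lintegral_const, measure_univ, mul_one]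
  have hz : Measurable fun a => ENNReal.ofReal (π.dens θ z.2 a) :=
    ((π.measurable_dens_right θ).comp measurable_prodMk_left).ennreal_ofReal
  rw [lintegral_mul_const _ hz, π.lintegral_dens, one_mul]

/-- Importance sampling with the truncated weight, for functions of one state-action pair. -/
theorem lintegral_prefixLaw_eq_weightUpTo [SFinite ν] (m : EpisodicMDP S A)
    (π : PolicyFamily d S ν) (θ₂ θ₁ : EuclideanSpace ℝ (Fin d)) (n : ℕ) (h : Fin n)
    {f : S × A → ENNReal} (hf : Measurable f) :
    ∫⁻ z, f (z.1 h) ∂(m.prefixLaw π θ₁ n) =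
      ∫⁻ z, ENNReal.ofReal (π.weightUpTo θ₂ θ₁ h z.1) * f (z.1 h) ∂(m.prefixLaw π θ₂ n) := by
  induction n with
  | zero => exact h.elim0
  | succ n ih =>
    -- For the last pair the truncated weight is the full weight; for an earlier pair nothing
    -- depends on the last one, which can be integrated out.
    induction h using Fin.lastCases with
    | last =>
      simp only [π.weightUpTo_last]
      exact lintegral_prefixLaw_eq_weight m π θ₂ θ₁ (n + 1) (hf.comp (by fun_prop))
    | cast h =>
      simp only [π.weightUpTo_castSucc]
      have h1 : Measurable fun τ : Fin n → S × A => f (τ h) := hf.comp (by fun_prop)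
      have h2 : Measurable fun τ : Fin n → S × A =>
          ENNReal.ofReal (π.weightUpTo θ₂ θ₁ h τ) * f (τ h) :=
        (π.measurable_weightUpTo θ₂ θ₁ h).ennreal_ofReal.mul h1
      rw [lintegral_prefixLaw_succ_castSucc m π θ₁ n h1, ih,
        ← lintegral_prefixLaw_succ_castSucc m π θ₂ n h2]

/-- Initial distribution and transitions do not depend on the parameter, so only the ratio of policy
densities survives. In particular all trajectory laws have densities with respect to a single one.
-/
theorem trajLaw_eq_withDensity [SFinite ν] (m : EpisodicMDP S A) (π : PolicyFamily d S ν)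
    (θ₂ θ₁ : EuclideanSpace ℝ (Fin d)) :
    m.trajLaw π θ₁ =
      (m.trajLaw π θ₂).withDensity fun τ => ENNReal.ofReal (π.weight θ₂ θ₁ τ) := by
  have hw := (π.measurable_weight (H := m.H) θ₂ θ₁).ennreal_ofReal
  refine Measure.ext_of_lintegral _ fun f hf => ?_
  rw [lintegral_withDensity_eq_lintegral_mul _ hw hf, trajLaw, trajLaw,
    lintegral_map hf measurable_fst, lintegral_map (hw.mul hf) measurable_fst]
  exact lintegral_prefixLaw_eq_weight m π θ₂ θ₁ m.H (hf.comp measurable_fst)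

/-- The pair at time `h` is determined by the randomness up to `h`, and later density ratios have
conditional mean one; this is why the truncated weights of `gpomdpOff` suffice. -/
theorem map_eval_trajLaw [SFinite ν] (m : EpisodicMDP S A) (π : PolicyFamily d S ν)
    (θ₂ θ₁ : EuclideanSpace ℝ (Fin d)) (h : Fin m.H) :
    (m.trajLaw π θ₁).map (fun τ => τ h) =
      ((m.trajLaw π θ₂).withDensity
        fun τ => ENNReal.ofReal (π.weightUpTo θ₂ θ₁ h τ)).map (fun τ => τ h) := by
  have hw := (π.measurable_weightUpTo (H := m.H) θ₂ θ₁ h).ennreal_ofReal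
  refine Measure.ext_of_lintegral _ fun f hf => ?_
  have hfh : Measurable fun τ : Trajectory m.H S A => f (τ h) := hf.comp (by fun_prop)
  rw [lintegral_map hf (by fun_prop), lintegral_map hf (by fun_prop),
    lintegral_withDensity_eq_lintegral_mul _ hw hfh, trajLaw, trajLaw,
    lintegral_map hfh measurable_fst, lintegral_map (hw.mul hfh) measurable_fst,
    lintegral_prefixLaw_eq_weightUpTo m π θ₂ θ₁ m.H h hf]
  rfl

theorem integral_trajLaw_eval [SFinite ν] (m : EpisodicMDP S A) (π : PolicyFamily d S ν)
    (θ₂ θ₁ : EuclideanSpace ℝ (Fin d)) (h : Fin m.H) {f : S × A → ℝ} (hf : Measurable f) :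
    ∫ τ, f (τ h) ∂(m.trajLaw π θ₁) =
      ∫ τ, π.weightUpTo θ₂ θ₁ h τ * f (τ h) ∂(m.trajLaw π θ₂) := by
  have hh : Measurable fun τ : Trajectory m.H S A => τ h := by fun_prop
  have h1 := congrArg (fun μ => ∫ x, f x ∂μ) (map_eval_trajLaw m π θ₂ θ₁ h)
  rw [integral_map hh.aemeasurable hf.aestronglyMeasurable,
    integral_map hh.aemeasurable hf.aestronglyMeasurable,
    integral_withDensity_eq_integral_toReal_smul
      (π.measurable_weightUpTo (H := m.H) θ₂ θ₁ h).ennreal_ofReal (by simp)] at h1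
  simpa only [ENNReal.toReal_ofReal (π.weightUpTo_pos θ₂ θ₁ h _).le, smul_eq_mul] using h1

/-- The trajectory law depends measurably on the parameter. -/
theorem measurable_trajLaw [SFinite ν] (m : EpisodicMDP S A) (π : PolicyFamily d S ν) :
    Measurable (m.trajLaw π) := by
  refine Measure.measurable_of_measurable_coe _ fun s hs => ?_
  -- The parameter `0` is an arbitrary reference: it moves the whole dependence on `θ` into a
  -- jointly measurable density.
  have h1 : (fun θ => m.trajLaw π θ s) =
      fun θ => ∫⁻ τ in s, ENNReal.ofReal (π.weight 0 θ τ) ∂(m.trajLaw π 0) := by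
    ext θ
    rw [trajLaw_eq_withDensity m π 0 θ, withDensity_apply _ hs]
  rw [h1]
  refine Measurable.lintegral_prod_right' (f := fun z : EuclideanSpace ℝ (Fin d) ×
    Trajectory m.H S A => ENNReal.ofReal (π.weight 0 z.1 z.2)) ?_
  exact (π.measurable_weight_joint.comp (by fun_prop : Measurable fun
    z : EuclideanSpace ℝ (Fin d) × Trajectory m.H S A =>
      (((0 : EuclideanSpace ℝ (Fin d)), z.1), z.2))).ennreal_ofReal

end EpisodicMDP

end ChangeOfMeasure

/-! ### Smoothness of the importance weights and of the estimators -/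

section Smoothness

/-- Partial sum of a binomial series. This sum and the next produce the two summands of `constL`. -/
theorem sum_pow_mul_succ_le {γ : ℝ} (h0 : 0 ≤ γ) (h1 : γ < 1) (H : ℕ) :
    ∑ h : Fin H, γ ^ (h : ℕ) * ((h : ℕ) + 1 : ℝ) ≤ 1 / (1 - γ) ^ 2 := by
  have hn : ‖γ‖ < 1 := by rwa [Real.norm_of_nonneg h0]
  have hs := summable_choose_mul_geometric_of_norm_lt_one 1 hn
  rw [Fin.sum_univ_eq_sum_range (fun h => γ ^ h * ((h : ℝ) + 1)) H,
    ← tsum_choose_mul_geometric_of_norm_lt_one 1 hn]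
  refine le_trans (Finset.sum_le_sum fun i _ => ?_)
    (hs.sum_le_tsum (Finset.range H) fun i _ => by positivity)
  simp [mul_comm]

/-- Termwise `(h + 1)² ≤ (h + 2)(h + 1) = 2 * (h + 2).choose 2`, and the binomial series sums to `1
/ (1 - γ)³`. -/
theorem sum_pow_mul_succ_sq_le {γ : ℝ} (h0 : 0 ≤ γ) (h1 : γ < 1) (H : ℕ) :
    ∑ h : Fin H, γ ^ (h : ℕ) * ((h : ℕ) + 1 : ℝ) ^ 2 ≤ 2 / (1 - γ) ^ 3 := by
  have hn : ‖γ‖ < 1 := by rwa [Real.norm_of_nonneg h0]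
  have hs := summable_choose_mul_geometric_of_norm_lt_one 2 hn
  have ht := tsum_choose_mul_geometric_of_norm_lt_one 2 hn
  have h2 : (2 : ℝ) / (1 - γ) ^ 3 = 2 * ∑' n : ℕ, ((n + 2).choose 2 : ℝ) * γ ^ n := by
    rw [ht]; ring
  rw [Fin.sum_univ_eq_sum_range (fun h => γ ^ h * ((h : ℝ) + 1) ^ 2) H, h2]
  refine le_trans ?_ (mul_le_mul_of_nonneg_left
    (hs.sum_le_tsum (Finset.range H) fun i _ => by positivity) zero_le_two)
  rw [Finset.mul_sum]
  refine Finset.sum_le_sum fun i _ => ?_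
  have hc : ((i + 2).choose 2 : ℝ) = ((i : ℝ) + 2) * (i + 1) / 2 := by
    rw [Nat.cast_choose_two]; push_cast; ring
  rw [hc]
  have : 0 ≤ γ ^ i := by positivity
  nlinarith [mul_nonneg this (by positivity : (0 : ℝ) ≤ i + 1)]

variable {d : ℕ} {S A : Type*} [MeasurableSpace S] [MeasurableSpace A] {ν : Measure A}

namespace PolicyFamily

variable {π : PolicyFamily d S ν} {G M : ℝ}

theorem hasGradientAt_log_dens (hs : π.SmoothPolicy M) (s : S) (a : A)
    (θ : EuclideanSpace ℝ (Fin d)) :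
    HasGradientAt (fun ϑ => Real.log (π.dens ϑ s a)) (π.score θ s a) θ :=
  (((hs s a).1 θ).log (π.dens_pos θ s a).ne').hasGradientAt

theorem differentiable_score (hs : π.SmoothPolicy M) (s : S) (a : A) :
    Differentiable ℝ fun θ => π.score θ s a := by
  have h1 : (fun θ => π.score θ s a) = fun θ =>
      (InnerProductSpace.toDual ℝ (EuclideanSpace ℝ (Fin d))).symm
        ((π.dens θ s a)⁻¹ • fderiv ℝ (fun ϑ => π.dens ϑ s a) θ) := by
    ext1 θ
    rw [score, gradient, fderiv.log ((hs s a).1 θ) (π.dens_pos θ s a).ne']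
  rw [h1]
  refine (InnerProductSpace.toDual ℝ
    (EuclideanSpace ℝ (Fin d))).symm.toContinuousLinearEquiv.differentiable.comp ?_
  exact ((hs s a).1.inv fun θ => (π.dens_pos θ s a).ne').smul (hs s a).2.1

theorem abs_log_dens_sub_le (hs : π.SmoothPolicy M) (hG : π.BoundedScore G) (s : S) (a : A)
    (θ₁ θ₂ : EuclideanSpace ℝ (Fin d)) :
    |Real.log (π.dens θ₁ s a) - Real.log (π.dens θ₂ s a)| ≤ G * ‖θ₁ - θ₂‖ := by
  rw [← Real.norm_eq_abs]
  refine convex_univ.norm_image_sub_le_of_norm_hasFDerivWithin_le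
    (f := fun θ => Real.log (π.dens θ s a))
    (fun θ _ => (hasGradientAt_log_dens hs s a θ).hasFDerivAt.hasFDerivWithinAt)
    (fun θ _ => ?_) (Set.mem_univ θ₂) (Set.mem_univ θ₁)
  rw [LinearIsometryEquiv.norm_map]
  exact hG s a θ

theorem weightUpTo_eq_exp (π : PolicyFamily d S ν) {H : ℕ} (θ₂ θ₁ : EuclideanSpace ℝ (Fin d))
    (h : Fin H) (τ : Trajectory H S A) :
    π.weightUpTo θ₂ θ₁ h τ = Real.exp (∑ j ∈ Finset.Iic h,
      (Real.log (π.dens θ₁ (τ j).1 (τ j).2) - Real.log (π.dens θ₂ (τ j).1 (τ j).2))) := by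
  rw [Real.exp_sum, weightUpTo]
  refine Finset.prod_congr rfl fun j _ => ?_
  rw [Real.exp_sub, Real.exp_log (π.dens_pos _ _ _), Real.exp_log (π.dens_pos _ _ _)]

theorem weightUpTo_self (π : PolicyFamily d S ν) {H : ℕ} (θ : EuclideanSpace ℝ (Fin d))
    (h : Fin H) (τ : Trajectory H S A) : π.weightUpTo θ θ h τ = 1 := by
  simp [weightUpTo_eq_exp]

/-- The log-weight is a sum of at most `H` log-density increments, each bounded by the mean value
inequality. This pathwise bound is what makes short steps harmless. -/
theorem weightUpTo_le_exp (hs : π.SmoothPolicy M) (hG : π.BoundedScore G) (hG0 : 0 ≤ G) {H : ℕ}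
    (θ₂ θ₁ : EuclideanSpace ℝ (Fin d)) (h : Fin H) (τ : Trajectory H S A) :
    π.weightUpTo θ₂ θ₁ h τ ≤ Real.exp (H * G * ‖θ₁ - θ₂‖) := by
  rw [weightUpTo_eq_exp, Real.exp_le_exp]
  refine (Finset.sum_le_sum fun j _ => (le_abs_self _).trans
    (abs_log_dens_sub_le hs hG _ _ θ₁ θ₂)).trans ?_
  rw [Finset.sum_const, nsmul_eq_mul, ← mul_assoc]
  gcongr
  exact (Finset.card_le_univ _).trans (by simp)

/-- Logarithmic derivative: the weight is the exponential of a sum whose gradient is the sum of the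
scores. -/
theorem hasGradientAt_weightUpTo (hs : π.SmoothPolicy M) {H : ℕ}
    (θ₂ θ : EuclideanSpace ℝ (Fin d)) (h : Fin H) (τ : Trajectory H S A) :
    HasGradientAt (fun ϑ => π.weightUpTo θ₂ ϑ h τ)
      (π.weightUpTo θ₂ θ h τ • ∑ z ∈ Finset.Iic h, π.score θ (τ z).1 (τ z).2) θ := by
  rw [hasGradientAt_iff_hasFDerivAt, map_smul, map_sum]
  simp only [π.weightUpTo_eq_exp]
  refine HasFDerivAt.exp (HasFDerivAt.fun_sum fun j _ => ?_)
  exact (hasGradientAt_log_dens hs _ _ θ).hasFDerivAt.sub_const _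

theorem norm_sum_score_le (hG : π.BoundedScore G) {H : ℕ} (θ : EuclideanSpace ℝ (Fin d))
    (h : Fin H) (τ : Trajectory H S A) :
    ‖∑ z ∈ Finset.Iic h, π.score θ (τ z).1 (τ z).2‖ ≤ ((h : ℕ) + 1) * G := by
  refine (norm_sum_le_of_le _ fun z _ => hG (τ z).1 (τ z).2 θ).trans ?_
  simp

end PolicyFamily

namespace EpisodicMDP

variable {π : PolicyFamily d S ν} {G M : ℝ}

theorem abs_pow_mul_reward_le (m : EpisodicMDP S A) (h : ℕ) (s : S) (a : A) :
    |m.γ ^ h * m.reward s a| ≤ m.γ ^ h * m.R := by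
  rw [abs_mul, abs_of_nonneg (pow_nonneg m.γ_pos.le h)]
  exact mul_le_mul_of_nonneg_left (m.abs_reward_le s a) (pow_nonneg m.γ_pos.le h)

theorem gpomdpOff_self (m : EpisodicMDP S A) (π : PolicyFamily d S ν)
    (θ : EuclideanSpace ℝ (Fin d)) (τ : Trajectory m.H S A) :
    m.gpomdpOff π θ θ τ = m.gpomdp π θ τ := by
  simp [gpomdpOff, gpomdp, PolicyFamily.weightUpTo_self]

/-- A crude bound without discounting; it serves integrability, domination and the bound on `∇V`,
none of which enters the constant `C`. -/
theorem norm_gpomdpOff_le (m : EpisodicMDP S A) (hs : π.SmoothPolicy M) (hG : π.BoundedScore G)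
    (hG0 : 0 ≤ G) (θ₂ θ₁ : EuclideanSpace ℝ (Fin d)) (τ : Trajectory m.H S A) :
    ‖m.gpomdpOff π θ₂ θ₁ τ‖ ≤
      m.H * (m.H * (m.R * G)) * Real.exp (m.H * G * ‖θ₁ - θ₂‖) := by
  have hR := m.R_pos.le
  have : ∀ h ∈ (Finset.univ : Finset (Fin m.H)),
      ‖(π.weightUpTo θ₂ θ₁ h τ * (m.γ ^ (h : ℕ) * m.reward (τ h).1 (τ h).2)) •
        ∑ z ∈ Finset.Iic h, π.score θ₁ (τ z).1 (τ z).2‖ ≤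
      m.H * (m.R * G) * Real.exp (m.H * G * ‖θ₁ - θ₂‖) := by
    intro h _
    rw [norm_smul, norm_mul, Real.norm_of_nonneg (π.weightUpTo_pos _ _ _ _).le, Real.norm_eq_abs]
    have h1 : |m.γ ^ (h : ℕ) * m.reward (τ h).1 (τ h).2| ≤ m.R :=
      (m.abs_pow_mul_reward_le _ _ _).trans
        (mul_le_of_le_one_left hR (pow_le_one₀ m.γ_pos.le m.γ_lt_one.le))
    have h2 : ‖∑ z ∈ Finset.Iic h, π.score θ₁ (τ z).1 (τ z).2‖ ≤ m.H * G := by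
      refine (PolicyFamily.norm_sum_score_le hG θ₁ h τ).trans ?_
      gcongr
      exact_mod_cast h.2
    calc _ ≤ Real.exp (m.H * G * ‖θ₁ - θ₂‖) * m.R * (m.H * G) := by
          gcongr
          exact PolicyFamily.weightUpTo_le_exp hs hG hG0 _ _ _ _
      _ = _ := by ring
  refine (norm_sum_le_of_le _ this).trans (le_of_eq ?_)
  simp [mul_assoc]

theorem norm_gpomdp_le (m : EpisodicMDP S A) (hs : π.SmoothPolicy M) (hG : π.BoundedScore G)
    (hG0 : 0 ≤ G) (θ : EuclideanSpace ℝ (Fin d)) (τ : Trajectory m.H S A) :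
    ‖m.gpomdp π θ τ‖ ≤ m.H * (m.H * (m.R * G)) := by
  simpa [gpomdpOff_self] using m.norm_gpomdpOff_le hs hG hG0 θ θ τ

/-- The estimator `g^ω` is Lipschitz in its target parameter. -/
theorem norm_gpomdpOff_sub_le (m : EpisodicMDP S A) (hs : π.SmoothPolicy M)
    (hG : π.BoundedScore G) (hG0 : 0 ≤ G) (hM0 : 0 ≤ M) (θ₂ θ₁ : EuclideanSpace ℝ (Fin d))
    (τ : Trajectory m.H S A) :
    ‖m.gpomdp π θ₂ τ - m.gpomdpOff π θ₂ θ₁ τ‖ ≤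
      m.constL G M * Real.exp (m.H * G * ‖θ₁ - θ₂‖) * ‖θ₁ - θ₂‖ := by
  have hR := m.R_pos.le
  have hγ := m.γ_pos.le
  set c : Fin m.H → ℝ := fun h => m.γ ^ (h : ℕ) * m.reward (τ h).1 (τ h).2 with hc
  set sc : Fin m.H → EuclideanSpace ℝ (Fin d) → EuclideanSpace ℝ (Fin d) :=
    fun h θ => ∑ z ∈ Finset.Iic h, π.score θ (τ z).1 (τ z).2 with hsc
  let w : Fin m.H → EuclideanSpace ℝ (Fin d) → ℝ := fun h θ => π.weightUpTo θ₂ θ h τ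
  let D : Fin m.H → EuclideanSpace ℝ (Fin d) →
      EuclideanSpace ℝ (Fin d) →L[ℝ] EuclideanSpace ℝ (Fin d) := fun h θ =>
    ∑ z ∈ Finset.Iic h, fderiv ℝ (fun ϑ => π.score ϑ (τ z).1 (τ z).2) θ
  have hD : ∀ h θ, HasFDerivAt (sc h) (D h θ) θ := fun h θ =>
    HasFDerivAt.fun_sum fun z _ => (PolicyFamily.differentiable_score hs _ _ θ).hasFDerivAt
  have hDn : ∀ h θ, ‖D h θ‖ ≤ ((h : ℕ) + 1) * M := by
    intro h θ
    refine (norm_sum_le_of_le _ fun z _ => (hs (τ z).1 (τ z).2).2.2 θ).trans ?_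
    simp
  -- Product rule: the derivative of the score sum, plus a rank-one term from the weight, whose
  -- gradient is again a multiple of the score sum.
  let F' : EuclideanSpace ℝ (Fin d) → EuclideanSpace ℝ (Fin d) →L[ℝ] EuclideanSpace ℝ (Fin d) :=
    fun θ => ∑ h, ((w h θ * c h) • D h θ +
      (c h • InnerProductSpace.toDual ℝ (EuclideanSpace ℝ (Fin d)) (w h θ • sc h θ)).smulRight
        (sc h θ))
  have hF : ∀ θ, HasFDerivAt (fun ϑ => m.gpomdpOff π θ₂ ϑ τ) (F' θ) θ := by
    intro θ
    refine HasFDerivAt.fun_sum fun h _ => ?_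
    exact ((PolicyFamily.hasGradientAt_weightUpTo hs θ₂ θ h τ).hasFDerivAt.mul_const (c h)).smul
      (hD h θ)
  -- The ball contains the segment from `θ₂` to `θ₁`, and on it the weights are at most the
  -- exponential at radius `‖θ₁ - θ₂‖`.
  have hF' : ∀ θ ∈ Metric.closedBall θ₂ ‖θ₁ - θ₂‖,
      ‖F' θ‖ ≤ m.constL G M * Real.exp (m.H * G * ‖θ₁ - θ₂‖) := by
    intro θ hθ
    set x := Real.exp (m.H * G * ‖θ₁ - θ₂‖) with hx
    have hx0 : 0 ≤ x := (Real.exp_pos _).le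
    have hw : ∀ h, w h θ ≤ x := fun h => by
      refine (PolicyFamily.weightUpTo_le_exp hs hG hG0 θ₂ θ h τ).trans (Real.exp_le_exp.2 ?_)
      gcongr
      simpa only [Metric.mem_closedBall, dist_eq_norm] using hθ
    have hterm : ∀ h ∈ (Finset.univ : Finset (Fin m.H)), ‖(w h θ * c h) • D h θ +
        (c h • InnerProductSpace.toDual ℝ (EuclideanSpace ℝ (Fin d)) (w h θ • sc h θ)).smulRight
          (sc h θ)‖ ≤
        x * (M * m.R * (m.γ ^ (h : ℕ) * ((h : ℕ) + 1)) +
          G ^ 2 * m.R * (m.γ ^ (h : ℕ) * ((h : ℕ) + 1) ^ 2)) := by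
      intro h _
      have hw0 : 0 ≤ w h θ := (π.weightUpTo_pos _ _ _ _).le
      have hc1 : |c h| ≤ m.γ ^ (h : ℕ) * m.R := m.abs_pow_mul_reward_le _ _ _
      have hs1 : ‖sc h θ‖ ≤ ((h : ℕ) + 1) * G := PolicyFamily.norm_sum_score_le hG θ h τ
      refine (norm_add_le _ _).trans ?_
      rw [ContinuousLinearMap.norm_smulRight_apply, norm_smul, norm_smul,
        LinearIsometryEquiv.norm_map, norm_smul, norm_mul, Real.norm_of_nonneg hw0,
        Real.norm_eq_abs]
      calc _ ≤ x * (m.γ ^ (h : ℕ) * m.R) * (((h : ℕ) + 1) * M) +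
            (m.γ ^ (h : ℕ) * m.R) * (x * (((h : ℕ) + 1) * G)) * (((h : ℕ) + 1) * G) := by
            gcongr
            exacts [hw h, hDn h θ, hw h]
        _ = _ := by ring
    refine (norm_sum_le_of_le _ hterm).trans ?_
    rw [← Finset.mul_sum, Finset.sum_add_distrib, ← Finset.mul_sum, ← Finset.mul_sum, mul_comm]
    refine mul_le_mul_of_nonneg_right ?_ hx0
    have e1 := mul_le_mul_of_nonneg_left (sum_pow_mul_succ_le hγ m.γ_lt_one m.H)
      (mul_nonneg hM0 hR)
    have e2 := mul_le_mul_of_nonneg_left (sum_pow_mul_succ_sq_le hγ m.γ_lt_one m.H)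
      (mul_nonneg (sq_nonneg G) hR)
    refine (add_le_add e1 e2).trans (le_of_eq ?_)
    rw [constL]
    ring
  have := (convex_closedBall θ₂ ‖θ₁ - θ₂‖).norm_image_sub_le_of_norm_hasFDerivWithin_le
    (fun θ _ => (hF θ).hasFDerivWithinAt) hF' (x := θ₂) (y := θ₁)
    (by simp) (by simp [dist_eq_norm])
  rwa [gpomdpOff_self, norm_sub_rev] at this

end EpisodicMDP

end Smoothness

/-! ### Measurability of the estimators and the policy gradient theorem -/

section PolicyGradient

variable {d : ℕ} {S A : Type*} [MeasurableSpace S] [MeasurableSpace A] {ν : Measure A}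

theorem EuclideanSpace.measurable_of_inner {X : Type*} [MeasurableSpace X]
    {f : X → EuclideanSpace ℝ (Fin d)}
    (hf : ∀ v : EuclideanSpace ℝ (Fin d), Measurable fun x => inner ℝ (f x) v) :
    Measurable f := by
  have h1 : f = fun x => ∑ i, (inner ℝ (f x) (EuclideanSpace.basisFun (Fin d) ℝ i)) •
      EuclideanSpace.basisFun (Fin d) ℝ i := by
    ext1 x
    simp_rw [real_inner_comm _ (f x)]
    exact ((EuclideanSpace.basisFun (Fin d) ℝ).sum_repr' (f x)).symm
  rw [h1]
  exact Finset.measurable_sum _ fun i _ => (hf _).smul_const _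

namespace PolicyFamily

variable {π : PolicyFamily d S ν} {G M : ℝ}

/-- Each directional derivative is a pointwise limit of difference quotients, which are jointly
measurable. -/
theorem measurable_score (hs : π.SmoothPolicy M) :
    Measurable fun z : EuclideanSpace ℝ (Fin d) × S × A => π.score z.1 z.2.1 z.2.2 := by
  refine EuclideanSpace.measurable_of_inner fun v => ?_
  have hm : ∀ n : ℕ, Measurable fun z : EuclideanSpace ℝ (Fin d) × S × A =>
      (n : ℝ) * (Real.log (π.dens (z.1 + (n : ℝ)⁻¹ • v) z.2.1 z.2.2) -
        Real.log (π.dens z.1 z.2.1 z.2.2)) := by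
    intro n
    have h1 : Measurable fun z : EuclideanSpace ℝ (Fin d) × S × A =>
        π.dens (z.1 + (n : ℝ)⁻¹ • v) z.2.1 z.2.2 :=
      π.measurable_dens.comp (by fun_prop : Measurable fun
        z : EuclideanSpace ℝ (Fin d) × S × A => (z.1 + (n : ℝ)⁻¹ • v, z.2))
    exact (h1.log.sub π.measurable_dens.log).const_mul _
  refine measurable_of_tendsto_metrizable hm (tendsto_pi_nhds.2 fun z => ?_)
  have h := (hasGradientAt_log_dens hs z.2.1 z.2.2 z.1).hasFDerivAt
  refine h.lim v (c := fun n : ℕ => (n : ℝ)) ?_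
  simpa using tendsto_natCast_atTop_atTop

end PolicyFamily

namespace EpisodicMDP

variable {π : PolicyFamily d S ν} {G M : ℝ}

theorem measurable_gpomdpOff_joint (m : EpisodicMDP S A) (hs : π.SmoothPolicy M) :
    Measurable fun z : (EuclideanSpace ℝ (Fin d) × EuclideanSpace ℝ (Fin d)) ×
      Trajectory m.H S A => m.gpomdpOff π z.1.1 z.1.2 z.2 := by
  unfold gpomdpOff
  refine Finset.measurable_sum _ fun h _ => Measurable.fun_smul ?_ ?_
  · refine (π.measurable_weightUpTo_joint h).mul (Measurable.const_mul ?_ _)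
    exact m.measurable_reward.comp (by fun_prop : Measurable fun
      z : (EuclideanSpace ℝ (Fin d) × EuclideanSpace ℝ (Fin d)) × Trajectory m.H S A => z.2 h)
  · refine Finset.measurable_sum _ fun j _ => ?_
    exact (PolicyFamily.measurable_score hs).comp (by fun_prop : Measurable fun
      z : (EuclideanSpace ℝ (Fin d) × EuclideanSpace ℝ (Fin d)) × Trajectory m.H S A =>
        (z.1.2, z.2 j))

theorem measurable_gpomdp_joint (m : EpisodicMDP S A) (hs : π.SmoothPolicy M) :
    Measurable fun z : EuclideanSpace ℝ (Fin d) × Trajectory m.H S A => m.gpomdp π z.1 z.2 := by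
  simp only [← gpomdpOff_self]
  have h : Measurable fun z : EuclideanSpace ℝ (Fin d) × Trajectory m.H S A =>
      ((z.1, z.1), z.2) := by fun_prop
  have h' := (m.measurable_gpomdpOff_joint hs).comp h
  rw [Function.comp_def] at h'
  exact h'

theorem measurable_gpomdpOff (m : EpisodicMDP S A) (hs : π.SmoothPolicy M)
    (θ₂ θ₁ : EuclideanSpace ℝ (Fin d)) : Measurable (m.gpomdpOff π θ₂ θ₁) := by
  have h := (m.measurable_gpomdpOff_joint hs).comp
    (measurable_prodMk_left (x := (θ₂, θ₁)) (β := Trajectory m.H S A))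
  rw [Function.comp_def] at h
  exact h

theorem measurable_gpomdp (m : EpisodicMDP S A) (hs : π.SmoothPolicy M)
    (θ : EuclideanSpace ℝ (Fin d)) : Measurable (m.gpomdp π θ) := by
  have h := (m.measurable_gpomdp_joint hs).comp
    (measurable_prodMk_left (x := θ) (β := Trajectory m.H S A))
  rw [Function.comp_def] at h
  exact h

theorem measurable_reward_eval (m : EpisodicMDP S A) (h : Fin m.H) :
    Measurable fun τ : Trajectory m.H S A => m.γ ^ (h : ℕ) * m.reward (τ h).1 (τ h).2 := by
  refine Measurable.const_mul ?_ _
  exact m.measurable_reward.comp (by fun_prop : Measurable fun τ : Trajectory m.H S A => τ h)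

variable [SFinite ν]

theorem integrable_gpomdpOff (m : EpisodicMDP S A) (hs : π.SmoothPolicy M)
    (hG : π.BoundedScore G) (hG0 : 0 ≤ G) (θ₂ θ₁ : EuclideanSpace ℝ (Fin d)) :
    Integrable (m.gpomdpOff π θ₂ θ₁) (m.trajLaw π θ₂) :=
  Integrable.of_bound (m.measurable_gpomdpOff hs θ₂ θ₁).aestronglyMeasurable _
    (ae_of_all _ fun τ => m.norm_gpomdpOff_le hs hG hG0 θ₂ θ₁ τ)

theorem integrable_gpomdp (m : EpisodicMDP S A) (hs : π.SmoothPolicy M)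
    (hG : π.BoundedScore G) (hG0 : 0 ≤ G) (θ : EuclideanSpace ℝ (Fin d)) :
    Integrable (m.gpomdp π θ) (m.trajLaw π θ) :=
  Integrable.of_bound (m.measurable_gpomdp hs θ).aestronglyMeasurable _
    (ae_of_all _ fun τ => m.norm_gpomdp_le hs hG hG0 θ τ)

theorem integrable_weightUpTo_mul_reward (m : EpisodicMDP S A) (hs : π.SmoothPolicy M)
    (hG : π.BoundedScore G) (hG0 : 0 ≤ G) (θ₂ θ₁ : EuclideanSpace ℝ (Fin d)) (h : Fin m.H) :
    Integrable (fun τ : Trajectory m.H S A => π.weightUpTo θ₂ θ₁ h τ *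
      (m.γ ^ (h : ℕ) * m.reward (τ h).1 (τ h).2)) (m.trajLaw π θ₂) := by
  refine Integrable.of_bound ((π.measurable_weightUpTo θ₂ θ₁ h).mul
    (m.measurable_reward_eval h)).aestronglyMeasurable
    (Real.exp (m.H * G * ‖θ₁ - θ₂‖) * (m.γ ^ (h : ℕ) * m.R)) (ae_of_all _ fun τ => ?_)
  rw [norm_mul, Real.norm_of_nonneg (π.weightUpTo_pos _ _ _ _).le, Real.norm_eq_abs]
  exact mul_le_mul (PolicyFamily.weightUpTo_le_exp hs hG hG0 _ _ _ _)
    (m.abs_pow_mul_reward_le _ _ _) (abs_nonneg _) (Real.exp_pos _).le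

/-- Off-policy representation of the objective. -/
theorem value_eq_integral_weightUpTo (m : EpisodicMDP S A) (hs : π.SmoothPolicy M)
    (hG : π.BoundedScore G) (hG0 : 0 ≤ G) (θ₂ θ₁ : EuclideanSpace ℝ (Fin d)) :
    m.value π θ₁ = ∫ τ, ∑ h, π.weightUpTo θ₂ θ₁ h τ *
      (m.γ ^ (h : ℕ) * m.reward (τ h).1 (τ h).2) ∂(m.trajLaw π θ₂) := by
  rw [integral_finsetSum _ fun h _ => m.integrable_weightUpTo_mul_reward hs hG hG0 θ₂ θ₁ h]
  have h1 : ∀ h : Fin m.H, Integrable (fun τ : Trajectory m.H S A =>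
      m.γ ^ (h : ℕ) * m.reward (τ h).1 (τ h).2) (m.trajLaw π θ₁) := fun h => by
    simpa [PolicyFamily.weightUpTo_self] using
      m.integrable_weightUpTo_mul_reward hs hG hG0 θ₁ θ₁ h
  simp only [value, discountedReward]
  rw [integral_finsetSum _ fun h _ => h1 h]
  refine Finset.sum_congr rfl fun h _ => ?_
  exact m.integral_trajLaw_eval π θ₂ θ₁ h
    (f := fun x => m.γ ^ (h : ℕ) * m.reward x.1 x.2) (m.measurable_reward.const_mul _)

/-- The policy gradient theorem, in its off-policy form. -/
theorem hasGradientAt_value (m : EpisodicMDP S A) (hs : π.SmoothPolicy M)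
    (hG : π.BoundedScore G) (hG0 : 0 ≤ G) (θ₂ θ : EuclideanSpace ℝ (Fin d)) :
    HasGradientAt (m.value π) (∫ τ, m.gpomdpOff π θ₂ θ τ ∂(m.trajLaw π θ₂)) θ := by
  have hR := m.R_pos.le
  -- With the sampling law frozen at `θ₂`, only the weights depend on the parameter, so one may
  -- differentiate under the integral; unit balls suffice for domination.
  rw [hasGradientAt_iff_hasFDerivAt, funext (m.value_eq_integral_weightUpTo hs hG hG0 θ₂)]
  have hL := (InnerProductSpace.toDual ℝ (EuclideanSpace ℝ (Fin d))).toContinuousLinearEquiv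
    |>.toContinuousLinearMap.integral_comp_comm (m.integrable_gpomdpOff hs hG hG0 θ₂ θ)
  change HasFDerivAt _ ((InnerProductSpace.toDual ℝ
    (EuclideanSpace ℝ (Fin d))).toContinuousLinearEquiv.toContinuousLinearMap _) θ
  rw [← hL]
  refine hasFDerivAt_integral_of_dominated_of_fderiv_le
    (F' := fun θ τ => InnerProductSpace.toDual ℝ _ (m.gpomdpOff π θ₂ θ τ))
    (bound := fun _ => m.H * (m.H * (m.R * G)) * Real.exp (m.H * G * (1 + ‖θ - θ₂‖)))
    (Metric.ball_mem_nhds θ one_pos)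
    (Eventually.of_forall fun ϑ => (Finset.measurable_sum _ fun h _ =>
      (π.measurable_weightUpTo θ₂ ϑ h).mul (m.measurable_reward_eval h)).aestronglyMeasurable)
    (integrable_finsetSum _ fun h _ => m.integrable_weightUpTo_mul_reward hs hG hG0 θ₂ θ h)
    ?_ (ae_of_all _ fun τ ϑ hϑ => ?_) (integrable_const _) (ae_of_all _ fun τ ϑ _ => ?_)
  · exact (InnerProductSpace.toDual ℝ
      (EuclideanSpace ℝ (Fin d))).continuous.comp_aestronglyMeasurable
        (m.measurable_gpomdpOff hs θ₂ θ).aestronglyMeasurable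
  · rw [LinearIsometryEquiv.norm_map]
    refine (m.norm_gpomdpOff_le hs hG hG0 θ₂ ϑ τ).trans ?_
    gcongr
    rw [Metric.mem_ball, dist_eq_norm] at hϑ
    calc ‖ϑ - θ₂‖ = ‖(ϑ - θ) + (θ - θ₂)‖ := by rw [sub_add_sub_cancel]
      _ ≤ _ := (norm_add_le _ _).trans (by linarith)
  · have : InnerProductSpace.toDual ℝ _ (m.gpomdpOff π θ₂ ϑ τ) = ∑ h : Fin m.H,
        (m.γ ^ (h : ℕ) * m.reward (τ h).1 (τ h).2) • InnerProductSpace.toDual ℝ _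
          (π.weightUpTo θ₂ ϑ h τ • ∑ z ∈ Finset.Iic h, π.score ϑ (τ z).1 (τ z).2) := by
      rw [gpomdpOff, map_sum]
      refine Finset.sum_congr rfl fun h _ => ?_
      rw [← map_smul, smul_smul, mul_comm]
    rw [this]
    exact HasFDerivAt.fun_sum fun h _ =>
      (PolicyFamily.hasGradientAt_weightUpTo hs θ₂ ϑ h τ).hasFDerivAt.mul_const _

theorem gradient_value (m : EpisodicMDP S A) (hs : π.SmoothPolicy M) (hG : π.BoundedScore G)
    (hG0 : 0 ≤ G) (θ₂ θ : EuclideanSpace ℝ (Fin d)) :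
    gradient (m.value π) θ = ∫ τ, m.gpomdpOff π θ₂ θ τ ∂(m.trajLaw π θ₂) :=
  (m.hasGradientAt_value hs hG hG0 θ₂ θ).gradient

theorem gradient_value_eq_integral_gpomdp (m : EpisodicMDP S A) (hs : π.SmoothPolicy M)
    (hG : π.BoundedScore G) (hG0 : 0 ≤ G) (θ : EuclideanSpace ℝ (Fin d)) :
    gradient (m.value π) θ = ∫ τ, m.gpomdp π θ τ ∂(m.trajLaw π θ) := by
  simp_rw [m.gradient_value hs hG hG0 θ θ, gpomdpOff_self]

theorem differentiable_value (m : EpisodicMDP S A) (hs : π.SmoothPolicy M)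
    (hG : π.BoundedScore G) (hG0 : 0 ≤ G) : Differentiable ℝ (m.value π) := fun θ =>
  (m.hasGradientAt_value hs hG hG0 θ θ).differentiableAt

theorem norm_gradient_value_le (m : EpisodicMDP S A) (hs : π.SmoothPolicy M)
    (hG : π.BoundedScore G) (hG0 : 0 ≤ G) (θ : EuclideanSpace ℝ (Fin d)) :
    ‖gradient (m.value π) θ‖ ≤ m.H * (m.H * (m.R * G)) := by
  rw [m.gradient_value_eq_integral_gpomdp hs hG hG0]
  simpa using norm_integral_le_of_norm_le_const (μ := m.trajLaw π θ)
    (ae_of_all _ fun τ => m.norm_gpomdp_le hs hG hG0 θ τ)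

theorem abs_value_le (m : EpisodicMDP S A) (π : PolicyFamily d S ν)
    (θ : EuclideanSpace ℝ (Fin d)) : |m.value π θ| ≤ m.H * m.R := by
  have h1 : ∀ τ, ‖m.discountedReward τ‖ ≤ m.H * m.R := fun τ => by
    refine (norm_sum_le_of_le (f := fun h : Fin m.H =>
      m.γ ^ (h : ℕ) * m.reward (τ h).1 (τ h).2) _ fun h _ =>
        (m.abs_pow_mul_reward_le _ _ _).trans (mul_le_of_le_one_left m.R_pos.le
          (pow_le_one₀ m.γ_pos.le m.γ_lt_one.le))).trans (by simp)
  simpa [value] using norm_integral_le_of_norm_le_const (μ := m.trajLaw π θ) (ae_of_all _ h1)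

/-- Both gradients are expectations under the one law at `θ₂`, so the pathwise Lipschitz bound
passes to the mean. -/
theorem norm_gradient_value_sub_le (m : EpisodicMDP S A) (hs : π.SmoothPolicy M)
    (hG : π.BoundedScore G) (hG0 : 0 ≤ G) (hM0 : 0 ≤ M) (θ₂ θ₁ : EuclideanSpace ℝ (Fin d)) :
    ‖gradient (m.value π) θ₂ - gradient (m.value π) θ₁‖ ≤
      m.constL G M * Real.exp (m.H * G * ‖θ₁ - θ₂‖) * ‖θ₁ - θ₂‖ := by
  rw [m.gradient_value_eq_integral_gpomdp hs hG hG0 θ₂, m.gradient_value hs hG hG0 θ₂ θ₁,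
    ← integral_sub (m.integrable_gpomdp hs hG hG0 θ₂) (m.integrable_gpomdpOff hs hG hG0 θ₂ θ₁)]
  simpa using norm_integral_le_of_norm_le_const (μ := m.trajLaw π θ₂)
    (ae_of_all _ fun τ => m.norm_gpomdpOff_sub_le hs hG hG0 hM0 θ₂ θ₁ τ)

theorem measurable_gradient_value (m : EpisodicMDP S A) (π : PolicyFamily d S ν) :
    Measurable (gradient (m.value π)) :=
  (InnerProductSpace.toDual ℝ (EuclideanSpace ℝ (Fin d))).symm.continuous.measurable.comp
    (measurable_fderiv ℝ _)

theorem constL_pos (m : EpisodicMDP S A) (hG : 0 < G) (hM : 0 < M) : 0 < m.constL G M := by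
  have := m.R_pos
  have := sub_pos.2 m.γ_lt_one
  rw [constL]
  positivity

/-- The radius `1 / (4 H G)` makes the squared exponential at most `exp (1/2) ≤ 2`. -/
theorem exp_horizon_mul_le (m : EpisodicMDP S A) (hG : 0 < G) {t : ℝ}
    (ht : t ≤ 1 / (4 * m.H * G)) : Real.exp (m.H * G * t) ^ 2 ≤ 2 := by
  have hH : (0 : ℝ) < m.H := by exact_mod_cast m.H_pos
  have h1 : m.H * G * t ≤ 1 / 4 := by
    calc m.H * G * t ≤ m.H * G * (1 / (4 * m.H * G)) := by gcongr
      _ = 1 / 4 := by field_simp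
  rw [← Real.exp_nat_mul]
  have h2 : ((2 : ℕ) : ℝ) * (m.H * G * t) ≤ 1 / 2 := by push_cast; linarith
  refine (Real.exp_le_exp.2 h2).trans ?_
  rw [← Real.le_log_iff_exp_le two_pos]
  linarith [Real.log_two_gt_d9]

/-- The descent lemma, for steps of bounded length. -/
theorem value_sub_le_inner (m : EpisodicMDP S A) (hs : π.SmoothPolicy M)
    (hG : π.BoundedScore G) (hG0 : 0 < G) (hM0 : 0 < M) (θ v : EuclideanSpace ℝ (Fin d))
    (hv : ‖v‖ ≤ 1 / (4 * m.H * G)) :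
    m.value π θ - m.value π (θ + v) ≤
      -inner ℝ (gradient (m.value π) θ) v + 2 * m.constL G M * ‖v‖ ^ 2 := by
  have hLp := (m.constL_pos hG0 hM0).le
  have hd : ∀ ϑ ∈ Metric.closedBall θ ‖v‖, HasFDerivWithinAt (m.value π)
      (InnerProductSpace.toDual ℝ _ (gradient (m.value π) ϑ)) (Metric.closedBall θ ‖v‖) ϑ :=
    fun ϑ _ => (m.differentiable_value hs hG hG0.le ϑ).hasGradientAt.hasFDerivAt.hasFDerivWithinAt
  have hb : ∀ ϑ ∈ Metric.closedBall θ ‖v‖,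
      ‖InnerProductSpace.toDual ℝ _ (gradient (m.value π) ϑ) -
        InnerProductSpace.toDual ℝ _ (gradient (m.value π) θ)‖ ≤ 2 * m.constL G M * ‖v‖ := by
    intro ϑ hϑ
    rw [Metric.mem_closedBall, dist_eq_norm] at hϑ
    rw [← map_sub, LinearIsometryEquiv.norm_map, norm_sub_rev]
    refine (m.norm_gradient_value_sub_le hs hG hG0.le hM0.le θ ϑ).trans ?_
    have he : Real.exp (m.H * G * ‖ϑ - θ‖) ≤ 2 := by
      have h1 := m.exp_horizon_mul_le hG0 (hϑ.trans hv)
      nlinarith [Real.exp_pos (m.H * G * ‖ϑ - θ‖)]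
    calc _ ≤ m.constL G M * 2 * ‖v‖ := by gcongr
      _ = _ := by ring
  -- Mean value inequality for the value minus its linearization at `θ`; the derivative of the
  -- difference is at most `2 L ‖v‖` on the ball.
  have := (convex_closedBall θ ‖v‖).norm_image_sub_le_of_norm_hasFDerivWithin_le' hd hb
    (x := θ) (y := θ + v) (by simp) (by simp)
  rw [add_sub_cancel_left, InnerProductSpace.toDual_apply_apply, Real.norm_eq_abs] at this
  have := (abs_le.1 this).1
  nlinarith

end EpisodicMDP

end PolicyGradient

/-! ### Empirical means and measurability of mixtures -/

section EmpiricalMean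

variable {d : ℕ} {Ω : Type*} [MeasurableSpace Ω]

theorem integrable_sq_add_mean_sub {μ : Measure Ω} [IsProbabilityMeasure μ] {y : Ω → ℝ} {K : ℝ}
    (hy : Measurable y) (hK : ∀ ω, |y ω| ≤ K) {n : ℕ} (c b : ℝ) :
    Integrable (fun τ : Fin n → Ω => (c + ((n : ℝ)⁻¹ * ∑ i, y (τ i) - b)) ^ 2)
      (Measure.pi fun _ => μ) := by
  have hyi : ∀ i : Fin n, MemLp (fun τ : Fin n → Ω => y (τ i)) 2 (Measure.pi fun _ => μ) :=
    fun i => MemLp.of_bound (hy.comp (measurable_pi_apply i)).aestronglyMeasurable K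
      (ae_of_all _ fun τ => hK (τ i))
  have hZ : MemLp (fun τ : Fin n → Ω => ∑ i, y (τ i)) 2 (Measure.pi fun _ => μ) :=
    memLp_finsetSum _ fun i _ => hyi i
  have hX : MemLp (fun τ : Fin n → Ω => c + ((n : ℝ)⁻¹ * ∑ i, y (τ i) - b)) 2
      (Measure.pi fun _ => μ) := (memLp_const c).add ((hZ.const_mul _).sub (memLp_const b))
  exact hX.integrable_sq

/-- Bias-variance decomposition: the centred sample mean has variance `Var y / n`, and the variance
is at most the second moment. -/
theorem integral_sq_add_mean_sub_le {μ : Measure Ω} [IsProbabilityMeasure μ] {y : Ω → ℝ} {K : ℝ}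
    (hy : Measurable y) (hK : ∀ ω, |y ω| ≤ K) {n : ℕ} (hn : n ≠ 0) (c : ℝ) :
    ∫ τ, (c + ((n : ℝ)⁻¹ * ∑ i, y (τ i) - ∫ ω, y ω ∂μ)) ^ 2 ∂(Measure.pi fun _ : Fin n => μ) ≤
      c ^ 2 + (n : ℝ)⁻¹ * ∫ ω, y ω ^ 2 ∂μ := by
  have hn' : (n : ℝ) ≠ 0 := by exact_mod_cast hn
  set P := Measure.pi fun _ : Fin n => μ
  have hy2 : MemLp y 2 μ := MemLp.of_bound hy.aestronglyMeasurable K (ae_of_all _ hK)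
  have hyi : ∀ i : Fin n, MemLp (fun τ : Fin n → Ω => y (τ i)) 2 P := fun i =>
    MemLp.of_bound (hy.comp (measurable_pi_apply i)).aestronglyMeasurable K
      (ae_of_all _ fun τ => hK (τ i))
  set Z : (Fin n → Ω) → ℝ := fun τ => ∑ i, y (τ i) with hZ
  have hZ2 : MemLp Z 2 P := memLp_finsetSum _ fun i _ => hyi i
  have hvar : Var[Z; P] = n * Var[y; μ] := by
    have := variance_sum_pi (μ := fun _ : Fin n => μ) (X := fun _ => y) fun _ => hy2
    have e : (∑ i : Fin n, fun ω : Fin n → Ω => y (ω i)) = Z := by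
      ext τ
      simp [hZ]
    rw [e] at this
    simpa using this
  have hmean : ∫ τ, Z τ ∂P = n * ∫ ω, y ω ∂μ := by
    rw [integral_finsetSum _ fun i _ => (hyi i).integrable one_le_two]
    have : ∀ i : Fin n, ∫ τ, y (τ i) ∂P = ∫ ω, y ω ∂μ := fun i => by
      have := (measurePreserving_eval (fun _ : Fin n => μ) i)
      rw [← this.map_eq, integral_map this.aemeasurable hy.aestronglyMeasurable]
    simp [this]
  set X : (Fin n → Ω) → ℝ := fun τ => (n : ℝ)⁻¹ * Z τ + (c - ∫ ω, y ω ∂μ) with hX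
  have hX2 : MemLp X 2 P := (hZ2.const_mul _).add (memLp_const _)
  have hXm : ∫ τ, X τ ∂P = c := by
    rw [integral_add ((hZ2.integrable one_le_two).const_mul _) (integrable_const _),
      integral_const_mul, hmean]
    simp
    field_simp
    ring
  have hXv : Var[X; P] = (n : ℝ)⁻¹ * Var[y; μ] := by
    rw [hX, variance_add_const (hZ2.aestronglyMeasurable.const_mul _), variance_const_mul, hvar]
    field_simp
  have h1 : ∫ τ, X τ ^ 2 ∂P = c ^ 2 + (n : ℝ)⁻¹ * Var[y; μ] := by
    have := variance_eq_sub hX2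
    rw [hXm, hXv] at this
    simp only [Pi.pow_apply] at this
    linarith
  calc _ = ∫ τ, X τ ^ 2 ∂P := by
        refine integral_congr_ae (ae_of_all _ fun τ => ?_)
        simp only [hX, hZ]
        ring
    _ ≤ _ := by
        rw [h1]
        gcongr
        exact variance_le_expectation_sq hy.aestronglyMeasurable

/-- The scalar statement summed over coordinates. `c` will be the error already present before
sampling, and is `0` for a fresh batch. -/
theorem norm_sq_add_mean_sub_le {μ : Measure Ω} [IsProbabilityMeasure μ]
    {Y : Ω → EuclideanSpace ℝ (Fin d)} {K : ℝ} (hY : Measurable Y) (hK : ∀ ω, ‖Y ω‖ ≤ K) {n : ℕ}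
    (hn : n ≠ 0) (c : EuclideanSpace ℝ (Fin d)) :
    Integrable (fun τ : Fin n → Ω => ‖c + ((n : ℝ)⁻¹ • ∑ i, Y (τ i) - ∫ ω, Y ω ∂μ)‖ ^ 2)
      (Measure.pi fun _ => μ) ∧
    ∫ τ, ‖c + ((n : ℝ)⁻¹ • ∑ i, Y (τ i) - ∫ ω, Y ω ∂μ)‖ ^ 2 ∂(Measure.pi fun _ : Fin n => μ) ≤
      ‖c‖ ^ 2 + (n : ℝ)⁻¹ * ∫ ω, ‖Y ω‖ ^ 2 ∂μ := by
  have hYk : ∀ k, Measurable fun ω => Y ω k := fun k =>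
    (EuclideanSpace.proj (𝕜 := ℝ) k).continuous.measurable.comp hY
  have hKk : ∀ k ω, |Y ω k| ≤ K := fun k ω => (PiLp.norm_apply_le (Y ω) k).trans (hK ω)
  have hYint : Integrable Y μ := Integrable.of_bound hY.aestronglyMeasurable K (ae_of_all _ hK)
  have hcoord : ∀ k, (∫ ω, Y ω ∂μ) k = ∫ ω, Y ω k ∂μ := fun k =>
    ((EuclideanSpace.proj (𝕜 := ℝ) k).integral_comp_comm hYint).symm
  have hint : ∀ k, Integrable (fun τ : Fin n → Ω =>
      (c k + ((n : ℝ)⁻¹ * ∑ i, Y (τ i) k - ∫ ω, Y ω k ∂μ)) ^ 2) (Measure.pi fun _ => μ) :=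
    fun k => integrable_sq_add_mean_sub (hYk k) (hKk k) (c k) _
  have hint' : ∀ k, Integrable (fun ω => Y ω k ^ 2) μ := fun k =>
    (MemLp.of_bound (hYk k).aestronglyMeasurable K (ae_of_all _ (hKk k)) :
      MemLp (fun ω => Y ω k) 2 μ).integrable_sq
  simp only [EuclideanSpace.real_norm_sq_eq, PiLp.add_apply, PiLp.sub_apply, PiLp.smul_apply,
    smul_eq_mul, hcoord, WithLp.ofLp_sum, Finset.sum_apply]
  refine ⟨integrable_finsetSum _ fun k _ => hint k, ?_⟩
  rw [integral_finsetSum _ fun k _ => hint k, integral_finsetSum _ fun k _ => hint' k,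
    Finset.mul_sum, ← Finset.sum_add_distrib]
  exact Finset.sum_le_sum fun k _ => integral_sq_add_mean_sub_le (hYk k) (hKk k) hn (c k)

theorem lintegral_ofReal_add_mul_min_le {P : Measure Ω} [IsProbabilityMeasure P] {f : Ω → ℝ}
    (hf : Integrable f P) (hf0 : ∀ ω, 0 ≤ f ω) {A b c q : ℝ} (hA : 0 ≤ A) (hb : 0 ≤ b)
    (hq : ∫ ω, f ω ∂P ≤ q) :
    ∫⁻ ω, ENNReal.ofReal (A + b * min (f ω) c) ∂P ≤ ENNReal.ofReal (A + b * q) := by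
  have h1 : Integrable (fun ω => A + b * f ω) P := (integrable_const A).add (hf.const_mul b)
  calc _ ≤ ∫⁻ ω, ENNReal.ofReal (A + b * f ω) ∂P := by
        refine lintegral_mono fun ω => ENNReal.ofReal_le_ofReal ?_
        gcongr
        exact min_le_left _ _
    _ = ENNReal.ofReal (∫ ω, (A + b * f ω) ∂P) :=
        (ofReal_integral_eq_lintegral_ofReal h1 (ae_of_all _ fun ω => by
          have := hf0 ω
          positivity)).symm
    _ ≤ _ := by
        refine ENNReal.ofReal_le_ofReal ?_
        rw [integral_add (integrable_const A) (hf.const_mul b), integral_const_mul]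
        simpa using mul_le_mul_of_nonneg_left hq hb

/-- Boxes form a generating π-system, and on a box the product measure is a finite product of
measurable functions. -/
theorem Measurable.measure_pi_const {X : Type*} [MeasurableSpace X] {κ : X → Measure Ω}
    [∀ x, IsProbabilityMeasure (κ x)] (hκ : Measurable κ) (n : ℕ) :
    Measurable fun x => Measure.pi fun _ : Fin n => κ x := by
  refine Measurable.measure_of_isPiSystem_of_isProbabilityMeasure generateFrom_pi.symm
    isPiSystem_pi ?_
  rintro _ ⟨t, ht, rfl⟩
  simp only [Measure.pi_pi]
  exact Finset.measurable_prod _ fun i _ =>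
    (Measure.measurable_coe (ht i (Set.mem_univ i))).comp hκ

theorem Measurable.measure_map_prodMk {X Z : Type*} [MeasurableSpace X] [MeasurableSpace Z]
    {κ : X → Measure Ω} [∀ x, IsProbabilityMeasure (κ x)] (hκ : Measurable κ) {F : X → Ω → Z}
    (hF : Measurable (Function.uncurry F)) : Measurable fun x => (κ x).map (F x) := by
  refine Measure.measurable_of_measurable_coe _ fun s hs => ?_
  let k : Kernel X Ω := ⟨κ, hκ⟩
  have : IsMarkovKernel k := ⟨fun x => inferInstanceAs (IsProbabilityMeasure (κ x))⟩
  have h1 := Kernel.measurable_kernel_prodMk_left (κ := k) (hF hs)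
  have h2 : ∀ x, (κ x).map (F x) s = k x (Prod.mk x ⁻¹' (Function.uncurry F ⁻¹' s)) := fun x => by
    have hFx : Measurable (F x) := hF.comp measurable_prodMk_left
    rw [Measure.map_apply hFx hs]
    rfl
  simpa only [h2] using h1

end EmpiricalMean

/-! ### The law of the iterates -/

section PageLaw

variable {d : ℕ} {S A : Type*} [MeasurableSpace S] [MeasurableSpace A] {ν : Measure A}

namespace EpisodicMDP

variable {π : PolicyFamily d S ν} {G M : ℝ}

theorem measurable_largeBatch (m : EpisodicMDP S A) (hs : π.SmoothPolicy M) (I : PageInput d) :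
    Measurable (Function.uncurry fun (x : PageState d) (τ : Fin I.N → Trajectory m.H S A) =>
      ((x.1 + I.η • x.2.1, (I.N : ℝ)⁻¹ • ∑ i, m.gpomdp π (x.1 + I.η • x.2.1) (τ i),
        x.2.2 + I.N) : PageState d)) := by
  have h1 : ∀ i, Measurable fun z : PageState d × (Fin I.N → Trajectory m.H S A) =>
      m.gpomdp π (z.1.1 + I.η • z.1.2.1) (z.2 i) := fun i => by
    have h : Measurable fun z : PageState d × (Fin I.N → Trajectory m.H S A) =>
      (z.1.1 + I.η • z.1.2.1, z.2 i) := by fun_prop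
    have h' := (m.measurable_gpomdp_joint hs).comp h
    rw [Function.comp_def] at h'
    exact h'
  have h3 := (Finset.measurable_sum Finset.univ fun i _ => h1 i).fun_const_smul (I.N : ℝ)⁻¹
  refine Measurable.prodMk (by fun_prop) (Measurable.prodMk ?_ ?_)
  · exact h3
  · exact (measurable_from_top (f := fun n : ℕ => n + I.N)).comp (by fun_prop)

theorem measurable_smallBatch (m : EpisodicMDP S A) (hs : π.SmoothPolicy M) (I : PageInput d) :
    Measurable (Function.uncurry fun (x : PageState d) (τ : Fin I.B → Trajectory m.H S A) =>
      ((x.1 + I.η • x.2.1, (I.B : ℝ)⁻¹ • ∑ i, m.gpomdp π (x.1 + I.η • x.2.1) (τ i) + x.2.1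
        - (I.B : ℝ)⁻¹ • ∑ i, m.gpomdpOff π (x.1 + I.η • x.2.1) x.1 (τ i),
        x.2.2 + I.B) : PageState d)) := by
  have h1 : ∀ i, Measurable fun z : PageState d × (Fin I.B → Trajectory m.H S A) =>
      m.gpomdp π (z.1.1 + I.η • z.1.2.1) (z.2 i) := fun i => by
    have h : Measurable fun z : PageState d × (Fin I.B → Trajectory m.H S A) =>
      (z.1.1 + I.η • z.1.2.1, z.2 i) := by fun_prop
    have h' := (m.measurable_gpomdp_joint hs).comp h
    rw [Function.comp_def] at h'
    exact h'
  have h2 : ∀ i, Measurable fun z : PageState d × (Fin I.B → Trajectory m.H S A) =>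
      m.gpomdpOff π (z.1.1 + I.η • z.1.2.1) z.1.1 (z.2 i) := fun i => by
    have h : Measurable fun z : PageState d × (Fin I.B → Trajectory m.H S A) =>
      ((z.1.1 + I.η • z.1.2.1, z.1.1), z.2 i) := by fun_prop
    have h' := (m.measurable_gpomdpOff_joint hs).comp h
    rw [Function.comp_def] at h'
    exact h'
  have h3 := (Finset.measurable_sum Finset.univ fun i _ => h1 i).fun_const_smul (I.B : ℝ)⁻¹
  have h4 := (Finset.measurable_sum Finset.univ fun i _ => h2 i).fun_const_smul (I.B : ℝ)⁻¹
  have h5 : Measurable fun z : PageState d × (Fin I.B → Trajectory m.H S A) => z.1.2.1 := by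
    fun_prop
  refine Measurable.prodMk (by fun_prop) (Measurable.prodMk ?_ ?_)
  · exact (h3.fun_add h5).fun_sub h4
  · exact (measurable_from_top (f := fun n : ℕ => n + I.B)).comp (by fun_prop)

theorem measurable_pageInit (m : EpisodicMDP S A) (hs : π.SmoothPolicy M) (I : PageInput d) :
    Measurable fun τ : Fin I.N → Trajectory m.H S A =>
      ((I.θ₀, (I.N : ℝ)⁻¹ • ∑ i, m.gpomdp π I.θ₀ (τ i), I.N) : PageState d) := by
  have h1 : ∀ i, Measurable fun τ : Fin I.N → Trajectory m.H S A => m.gpomdp π I.θ₀ (τ i) :=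
    fun i => (m.measurable_gpomdp hs I.θ₀).comp (measurable_pi_apply i)
  have h2 := (Finset.measurable_sum Finset.univ fun i _ => h1 i).fun_const_smul (I.N : ℝ)⁻¹
  exact measurable_const.prodMk (h2.prodMk measurable_const)

variable [SFinite ν]

/-- Needed for `Measure.bind` in `pageLaw` to integrate as an iterated integral. -/
theorem measurable_pageStep (m : EpisodicMDP S A) (hs : π.SmoothPolicy M) (I : PageInput d) :
    Measurable (m.pageStep π I) := by
  have hθ : Measurable fun x : PageState d => m.trajLaw π (x.1 + I.η • x.2.1) :=
    (m.measurable_trajLaw π).comp (by fun_prop)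
  have hL := (hθ.measure_pi_const I.N).measure_map_prodMk (m.measurable_largeBatch hs I)
  have hS := (hθ.measure_pi_const I.B).measure_map_prodMk (m.measurable_smallBatch hs I)
  refine Measure.measurable_of_measurable_coe _ fun s hs => ?_
  simp only [pageStep, Measure.coe_add, Measure.coe_smul, Pi.add_apply, Pi.smul_apply,
    smul_eq_mul]
  exact (((Measure.measurable_coe hs).comp hL).const_mul _).add
    (((Measure.measurable_coe hs).comp hS).const_mul _)

theorem lintegral_pageStep (m : EpisodicMDP S A) (hs : π.SmoothPolicy M) (I : PageInput d)
    (x : PageState d) {f : PageState d → ENNReal} (hf : Measurable f) :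
    ∫⁻ y, f y ∂(m.pageStep π I x) =
      ENNReal.ofReal I.p * ∫⁻ τ, f (x.1 + I.η • x.2.1,
        (I.N : ℝ)⁻¹ • ∑ i, m.gpomdp π (x.1 + I.η • x.2.1) (τ i), x.2.2 + I.N)
          ∂(Measure.pi fun _ : Fin I.N => m.trajLaw π (x.1 + I.η • x.2.1)) +
      ENNReal.ofReal (1 - I.p) * ∫⁻ τ, f (x.1 + I.η • x.2.1,
        (I.B : ℝ)⁻¹ • ∑ i, m.gpomdp π (x.1 + I.η • x.2.1) (τ i) + x.2.1
          - (I.B : ℝ)⁻¹ • ∑ i, m.gpomdpOff π (x.1 + I.η • x.2.1) x.1 (τ i), x.2.2 + I.B)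
          ∂(Measure.pi fun _ : Fin I.B => m.trajLaw π (x.1 + I.η • x.2.1)) := by
  have hL := (m.measurable_largeBatch hs I).comp (measurable_prodMk_left (x := x))
  have hS := (m.measurable_smallBatch hs I).comp (measurable_prodMk_left (x := x))
  rw [Function.comp_def] at hL hS
  simp only [Function.uncurry] at hL hS
  rw [pageStep, lintegral_add_measure, lintegral_smul_measure, lintegral_smul_measure,
    lintegral_map hf hL, lintegral_map hf hS]
  rfl

theorem isProbabilityMeasure_pageStep (m : EpisodicMDP S A) (hs : π.SmoothPolicy M)
    (I : PageInput d) (h0 : 0 ≤ I.p) (h1 : I.p ≤ 1) (x : PageState d) :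
    IsProbabilityMeasure (m.pageStep π I x) := by
  refine ⟨?_⟩
  have := m.lintegral_pageStep hs I x (f := fun _ => 1) measurable_const
  simp only [lintegral_const, measure_univ, mul_one, one_mul] at this
  rw [this, ← ENNReal.ofReal_add h0 (sub_nonneg.2 h1)]
  simp

theorem isProbabilityMeasure_pageLaw (m : EpisodicMDP S A) (hs : π.SmoothPolicy M)
    (I : PageInput d) (h0 : 0 ≤ I.p) (h1 : I.p ≤ 1) (t : ℕ) :
    IsProbabilityMeasure (m.pageLaw π I t) := by
  induction t with
  | zero => exact Measure.isProbabilityMeasure_map (m.measurable_pageInit hs I).aemeasurable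
  | succ t ih =>
    have := m.isProbabilityMeasure_pageStep hs I h0 h1
    refine ⟨?_⟩
    rw [pageLaw, Measure.bind_apply MeasurableSet.univ (m.measurable_pageStep hs I).aemeasurable]
    simp

theorem lintegral_pageLaw_succ (m : EpisodicMDP S A) (hs : π.SmoothPolicy M) (I : PageInput d)
    (t : ℕ) {f : PageState d → ENNReal} (hf : Measurable f) :
    ∫⁻ y, f y ∂(m.pageLaw π I (t + 1)) =
      ∫⁻ x, ∫⁻ y, f y ∂(m.pageStep π I x) ∂(m.pageLaw π I t) :=
  Measure.lintegral_bind (m.measurable_pageStep hs I).aemeasurable hf.aemeasurable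

theorem measurable_count : Measurable fun x : PageState d => (x.2.2 : ENNReal) :=
  (measurable_from_top (f := fun n : ℕ => (n : ENNReal))).comp (by fun_prop)

/-- One iteration draws `p N + (1 - p) B` trajectories on average, and `p N = 1`. -/
theorem lintegral_count_pageLaw_le (m : EpisodicMDP S A) (hs : π.SmoothPolicy M)
    (I : PageInput d) (hN : I.N ≠ 0) (hp : I.p = 1 / (I.N : ℝ)) (t : ℕ) :
    ∫⁻ x, (x.2.2 : ENNReal) ∂(m.pageLaw π I t) ≤ I.N + t * (1 + I.B) := by
  have hN1 : (1 : ℝ) ≤ I.N := by exact_mod_cast Nat.one_le_iff_ne_zero.2 hN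
  have h0 : 0 ≤ I.p := by rw [hp]; positivity
  have h1 : I.p ≤ 1 := by rw [hp]; exact div_le_one_of_le₀ hN1 (by positivity)
  induction t with
  | zero =>
    rw [pageLaw, pageInit, lintegral_map measurable_count (m.measurable_pageInit hs I)]
    simp
  | succ t ih =>
    have := m.isProbabilityMeasure_pageLaw hs I h0 h1 t
    have hstep : ∀ x : PageState d, ∫⁻ y, (y.2.2 : ENNReal) ∂(m.pageStep π I x) ≤
        x.2.2 + (1 + I.B) := by
      intro x
      rw [m.lintegral_pageStep hs I x measurable_count]
      simp only [lintegral_const, measure_univ, mul_one, Nat.cast_add]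
      have e1 : ENNReal.ofReal I.p * I.N = 1 := by
        rw [← ENNReal.ofReal_natCast, ← ENNReal.ofReal_mul h0, hp,
          one_div_mul_cancel (by positivity), ENNReal.ofReal_one]
      have e2 : ENNReal.ofReal I.p + ENNReal.ofReal (1 - I.p) = 1 := by
        rw [← ENNReal.ofReal_add h0 (sub_nonneg.2 h1)]
        simp
      have e3 : ENNReal.ofReal (1 - I.p) ≤ 1 := ENNReal.ofReal_le_one.2 (by linarith)
      calc _ = (ENNReal.ofReal I.p + ENNReal.ofReal (1 - I.p)) * x.2.2 +
            (ENNReal.ofReal I.p * I.N + ENNReal.ofReal (1 - I.p) * I.B) := by ring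
        _ ≤ 1 * x.2.2 + (1 + 1 * I.B) := by rw [e1, e2]; gcongr
        _ = _ := by ring
    rw [m.lintegral_pageLaw_succ hs I t measurable_count]
    calc _ ≤ ∫⁻ x, ((x.2.2 : ENNReal) + (1 + I.B)) ∂(m.pageLaw π I t) := lintegral_mono hstep
      _ = ∫⁻ x, (x.2.2 : ENNReal) ∂(m.pageLaw π I t) + (1 + I.B) := by
          rw [lintegral_add_left measurable_count]
          simp
      _ ≤ I.N + t * (1 + I.B) + (1 + I.B) := by gcongr
      _ = _ := by push_cast; ring

theorem integrable_count_pageLaw (m : EpisodicMDP S A) (hs : π.SmoothPolicy M)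
    (I : PageInput d) (hN : I.N ≠ 0) (hp : I.p = 1 / (I.N : ℝ)) (t : ℕ) :
    Integrable (fun x : PageState d => (x.2.2 : ℝ)) (m.pageLaw π I t) := by
  refine ⟨(((measurable_from_top (f := fun n : ℕ => (n : ℝ))).comp
    (by fun_prop : Measurable fun x : PageState d => x.2.2))).aestronglyMeasurable, ?_⟩
  have := m.lintegral_count_pageLaw_le hs I hN hp t
  rw [HasFiniteIntegral]
  simp only [Real.enorm_natCast]
  exact this.trans_lt (by finiteness)

theorem pageExpectedTrajectories_le (m : EpisodicMDP S A) (hs : π.SmoothPolicy M)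
    (I : PageInput d) (hN : I.N ≠ 0) (hp : I.p = 1 / (I.N : ℝ)) (t : ℕ) :
    m.pageExpectedTrajectories π I t ≤ I.N + t * (1 + I.B) := by
  have h := m.lintegral_count_pageLaw_le hs I hN hp t
  rw [pageExpectedTrajectories, integral_eq_lintegral_of_nonneg_ae
    (ae_of_all _ fun x => Nat.cast_nonneg _)
    (m.integrable_count_pageLaw hs I hN hp t).aestronglyMeasurable]
  simp only [ENNReal.ofReal_natCast]
  refine (ENNReal.toReal_mono (by finiteness) h).trans (le_of_eq ?_)
  have : ((I.N : ENNReal) + t * (1 + I.B)) = ((I.N + t * (1 + I.B) : ℕ) : ENNReal) := by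
    push_cast
    rfl
  rw [this, ENNReal.toReal_natCast]
  push_cast
  rfl

theorem integrable_norm_gradient_sq_pageLaw (m : EpisodicMDP S A) (hs : π.SmoothPolicy M)
    (hG : π.BoundedScore G) (hG0 : 0 ≤ G) (I : PageInput d) (h0 : 0 ≤ I.p) (h1 : I.p ≤ 1)
    (t : ℕ) :
    Integrable (fun x : PageState d => ‖gradient (m.value π) x.1‖ ^ 2) (m.pageLaw π I t) := by
  have := m.isProbabilityMeasure_pageLaw hs I h0 h1 t
  refine Integrable.of_bound (((m.measurable_gradient_value π).comp
    measurable_fst).norm.pow_const 2).aestronglyMeasurable ((m.H * (m.H * (m.R * G))) ^ 2)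
    (ae_of_all _ fun x => ?_)
  rw [Real.norm_of_nonneg (by positivity)]
  exact pow_le_pow_left₀ (norm_nonneg _) (m.norm_gradient_value_le hs hG hG0 x.1) 2

end EpisodicMDP

end PageLaw

/-! ### The Lyapunov function -/

section Lyapunov

variable {d : ℕ} {S A : Type*} [MeasurableSpace S] [MeasurableSpace A] {ν : Measure A} [SFinite ν]

namespace EpisodicMDP

variable {π : PolicyFamily d S ν} {G M σ : ℝ}

/-- Optimality gap plus a multiple of the squared estimation error, the latter truncated at
`a ^ 2`. -/
noncomputable def lyapunov (m : EpisodicMDP S A) (π : PolicyFamily d S ν) (b a : ℝ) (x : PageState d) : ℝ :=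
  (m.H * m.R - m.value π x.1) + b * min (‖x.2.1 - gradient (m.value π) x.1‖ ^ 2) (a ^ 2)

theorem measurable_lyapunov (m : EpisodicMDP S A) (hs : π.SmoothPolicy M)
    (hG : π.BoundedScore G) (hG0 : 0 ≤ G) (b a : ℝ) :
    Measurable fun x : PageState d => ENNReal.ofReal (m.lyapunov π b a x) := by
  have h1 : Measurable fun x : PageState d => m.value π x.1 :=
    (m.differentiable_value hs hG hG0).continuous.measurable.comp measurable_fst
  have h2 : Measurable fun x : PageState d => gradient (m.value π) x.1 :=
    (m.measurable_gradient_value π).comp measurable_fst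
  have h3 : Measurable fun x : PageState d => x.2.1 - gradient (m.value π) x.1 :=
    measurable_snd.fst.sub h2
  exact ((measurable_const.sub h1).add
    (((h3.norm.pow_const 2).min measurable_const).const_mul b)).ennreal_ofReal

theorem integral_norm_gpomdp_sub_sq_le (m : EpisodicMDP S A) (hs : π.SmoothPolicy M)
    (hG : π.BoundedScore G) (hG0 : 0 ≤ G) (hvar : m.FiniteVariance π σ)
    (θ : EuclideanSpace ℝ (Fin d)) :
    ∫ τ, ‖m.gpomdp π θ τ - gradient (m.value π) θ‖ ^ 2 ∂(m.trajLaw π θ) ≤ σ ^ 2 := by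
  have h := hvar θ
  rw [← m.gradient_value_eq_integral_gpomdp hs hG hG0] at h
  rw [integral_eq_lintegral_of_nonneg_ae (ae_of_all _ fun τ => by positivity)
    (((m.measurable_gpomdp hs θ).sub_const _).norm.pow_const 2).aestronglyMeasurable]
  refine ENNReal.toReal_le_of_le_ofReal (sq_nonneg σ) ?_
  simpa only [ENNReal.ofReal_pow (norm_nonneg _), ofReal_norm] using h

/-- The estimation error of a batch of `n` trajectories. -/
theorem norm_mean_gpomdp_sub_sq_le (m : EpisodicMDP S A) (hs : π.SmoothPolicy M)
    (hG : π.BoundedScore G) (hG0 : 0 ≤ G) (hvar : m.FiniteVariance π σ)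
    (θ : EuclideanSpace ℝ (Fin d)) {n : ℕ} (hn : n ≠ 0) :
    Integrable (fun τ : Fin n → Trajectory m.H S A =>
      ‖(n : ℝ)⁻¹ • ∑ i, m.gpomdp π θ (τ i) - gradient (m.value π) θ‖ ^ 2)
        (Measure.pi fun _ => m.trajLaw π θ) ∧
    ∫ τ, ‖(n : ℝ)⁻¹ • ∑ i, m.gpomdp π θ (τ i) - gradient (m.value π) θ‖ ^ 2
      ∂(Measure.pi fun _ : Fin n => m.trajLaw π θ) ≤ σ ^ 2 / n := by
  have hn' : (n : ℝ) ≠ 0 := by exact_mod_cast hn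
  set μ := m.trajLaw π θ
  set k := gradient (m.value π) θ with hk
  -- The estimator is unbiased, so the variance assumption bounds its squared distance to the true
  -- gradient.
  have hZ : ∫ τ, (m.gpomdp π θ τ - k) ∂μ = 0 := by
    rw [integral_sub (m.integrable_gpomdp hs hG hG0 θ) (integrable_const _),
      ← m.gradient_value_eq_integral_gpomdp hs hG hG0]
    simp [hk]
  have h := norm_sq_add_mean_sub_le (μ := μ)
    (Y := fun τ => m.gpomdp π θ τ - k) (K := m.H * (m.H * (m.R * G)) + ‖k‖)
    ((m.measurable_gpomdp hs θ).sub_const _)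
    (fun τ => (norm_sub_le _ _).trans (by gcongr; exact m.norm_gpomdp_le hs hG hG0 θ τ)) hn 0
  rw [hZ] at h
  have e : ∀ τ : Fin n → Trajectory m.H S A,
      (0 : EuclideanSpace ℝ (Fin d)) + ((n : ℝ)⁻¹ • ∑ i, (m.gpomdp π θ (τ i) - k) - 0) =
        (n : ℝ)⁻¹ • ∑ i, m.gpomdp π θ (τ i) - k := by
    intro τ
    rw [Finset.sum_sub_distrib, smul_sub, Finset.sum_const, Finset.card_univ, Fintype.card_fin,
      ← Nat.cast_smul_eq_nsmul ℝ, smul_smul, inv_mul_cancel₀ hn', one_smul, zero_add, sub_zero]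
  simp only [e] at h
  refine ⟨h.1, h.2.trans ?_⟩
  rw [norm_zero, zero_pow two_ne_zero, zero_add, inv_mul_eq_div]
  gcongr
  exact m.integral_norm_gpomdp_sub_sq_le hs hG hG0 hvar θ

/-- The estimation error after a small-batch correction, for steps of bounded length. -/
theorem norm_correction_sub_sq_le (m : EpisodicMDP S A) (hs : π.SmoothPolicy M)
    (hG : π.BoundedScore G) (hG0 : 0 < G) (hM0 : 0 < M) (θ θ' v : EuclideanSpace ℝ (Fin d))
    (hθ : ‖θ - θ'‖ ≤ 1 / (4 * m.H * G)) {n : ℕ} (hn : n ≠ 0) :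
    Integrable (fun τ : Fin n → Trajectory m.H S A =>
      ‖(n : ℝ)⁻¹ • ∑ i, m.gpomdp π θ' (τ i) + v - (n : ℝ)⁻¹ • ∑ i, m.gpomdpOff π θ' θ (τ i)
        - gradient (m.value π) θ'‖ ^ 2) (Measure.pi fun _ => m.trajLaw π θ') ∧
    ∫ τ, ‖(n : ℝ)⁻¹ • ∑ i, m.gpomdp π θ' (τ i) + v - (n : ℝ)⁻¹ • ∑ i, m.gpomdpOff π θ' θ (τ i)
        - gradient (m.value π) θ'‖ ^ 2 ∂(Measure.pi fun _ : Fin n => m.trajLaw π θ') ≤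
      ‖v - gradient (m.value π) θ‖ ^ 2 + 2 * m.constL G M ^ 2 * ‖θ - θ'‖ ^ 2 / n := by
  set μ := m.trajLaw π θ'
  set D := ‖θ - θ'‖ with hD
  have hL := (m.constL_pos hG0 hM0).le
  -- Since `g - g^ω` has mean `∇V(θ') - ∇V(θ)`, the new error is the old error plus a centred sample
  -- mean.
  have hY : ∫ τ, (m.gpomdp π θ' τ - m.gpomdpOff π θ' θ τ) ∂μ =
      gradient (m.value π) θ' - gradient (m.value π) θ := by
    rw [integral_sub (m.integrable_gpomdp hs hG hG0.le θ')
      (m.integrable_gpomdpOff hs hG hG0.le θ' θ),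
      ← m.gradient_value_eq_integral_gpomdp hs hG hG0.le, ← m.gradient_value hs hG hG0.le]
  have hb := m.norm_gpomdpOff_sub_le hs hG hG0.le hM0.le θ' θ
  have h := norm_sq_add_mean_sub_le (μ := μ)
    ((m.measurable_gpomdp hs θ').sub (m.measurable_gpomdpOff hs θ' θ)) hb hn
    (v - gradient (m.value π) θ)
  simp only [Pi.sub_apply] at h
  rw [hY] at h
  have e : ∀ τ : Fin n → Trajectory m.H S A,
      (v - gradient (m.value π) θ) +
        ((n : ℝ)⁻¹ • ∑ i, (m.gpomdp π θ' (τ i) - m.gpomdpOff π θ' θ (τ i)) -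
          (gradient (m.value π) θ' - gradient (m.value π) θ)) =
      (n : ℝ)⁻¹ • ∑ i, m.gpomdp π θ' (τ i) + v - (n : ℝ)⁻¹ • ∑ i, m.gpomdpOff π θ' θ (τ i)
        - gradient (m.value π) θ' := by
    intro τ
    rw [Finset.sum_sub_distrib, smul_sub]
    abel
  simp only [e] at h
  refine ⟨h.1, h.2.trans ?_⟩
  rw [inv_mul_eq_div]
  gcongr
  have hsq : ∀ τ, ‖‖m.gpomdp π θ' τ - m.gpomdpOff π θ' θ τ‖ ^ 2‖ ≤
      2 * m.constL G M ^ 2 * D ^ 2 := by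
    intro τ
    rw [Real.norm_of_nonneg (by positivity)]
    refine (pow_le_pow_left₀ (norm_nonneg _) (hb τ) 2).trans ?_
    rw [mul_pow, mul_pow]
    have := m.exp_horizon_mul_le hG0 hθ
    calc _ ≤ m.constL G M ^ 2 * 2 * D ^ 2 := by gcongr
      _ = _ := by ring
  have := norm_integral_le_of_norm_le_const (μ := μ) (ae_of_all _ hsq)
  exact (le_abs_self _).trans (by simpa using this)

/-- The parameters are such that PAGE-PG makes progress in every iteration: the estimation error is
truncated at `1 / (8 H G η)`. -/
structure GoodInput (m : EpisodicMDP S A) (I : PageInput d) (G M : ℝ) : Prop where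
  N_ne_zero : I.N ≠ 0
  B_ne_zero : I.B ≠ 0
  η_pos : 0 < I.η
  p_eq : I.p = 1 / (I.N : ℝ)
  smooth : 8 * m.constL G M * I.η ≤ 1
  batch : 4 * m.constL G M ^ 2 * I.N * I.η ^ 2 ≤ I.B
  short : I.η * (m.H * (m.H * (m.R * G))) ≤ 1 / (8 * m.H * G)
  escape : 2 * (m.H * m.R) + I.η / 2 * (m.H * (m.H * (m.R * G))) ^ 2 ≤
    I.η / 2 * (1 / (8 * m.H * G) / I.η) ^ 2

namespace GoodInput

variable {m : EpisodicMDP S A} {I : PageInput d}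

theorem p_nonneg (h : GoodInput m I G M) : 0 ≤ I.p := by
  rw [h.p_eq]; positivity

theorem p_le_one (h : GoodInput m I G M) : I.p ≤ 1 := by
  have : (1 : ℝ) ≤ I.N := by exact_mod_cast Nat.one_le_iff_ne_zero.2 h.N_ne_zero
  rw [h.p_eq]
  exact div_le_one_of_le₀ this (by positivity)

end GoodInput

/-- Real-number inequality behind one iteration, when the estimation error is below the
truncation level. -/
theorem descent_inequality {η N B L e k s i V V' c σ : ℝ} (hη : 0 < η) (hN : 1 ≤ N) (hB : 0 < B)
    (hL : 8 * L * η ≤ 1) (hNB : 4 * L ^ 2 * N * η ^ 2 ≤ B)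
    (hi : e ^ 2 = s ^ 2 + k ^ 2 - 2 * i)
    (hV : V - V' ≤ -(η * i) + 2 * L * (η * s) ^ 2) :
    1 / N * ((c - V') + η * N / 2 * (σ ^ 2 / N)) +
      (1 - 1 / N) * ((c - V') + η * N / 2 * (e ^ 2 + 2 * L ^ 2 * (η * s) ^ 2 / B)) +
      η / 2 * k ^ 2 ≤ ((c - V) + η * N / 2 * e ^ 2) + η / 2 * (σ ^ 2 / N) := by
  have hN0 : 0 < N := by linarith
  -- With `s = ‖v‖`, `k = ‖∇V‖`, `e` the error and `i = ⟨∇V, v⟩`, the small-batch noise (`h1`) and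
  -- the second-order remainder (`h2`) each cost at most `η/4 s²`.
  have h1 : (1 - 1 / N) * (η * N / 2 * (2 * L ^ 2 * (η * s) ^ 2 / B)) ≤ η / 4 * s ^ 2 := by
    have e1 : η * N / 2 * (2 * L ^ 2 * (η * s) ^ 2 / B) =
        η / 4 * s ^ 2 * (4 * L ^ 2 * N * η ^ 2 / B) := by
      field_simp
    have e2 : 4 * L ^ 2 * N * η ^ 2 / B ≤ 1 := div_le_one_of_le₀ hNB hB.le
    have e3 : (1 - 1 / N) ≤ 1 := by
      have : 0 < 1 / N := by positivity
      linarith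
    rw [e1]
    have e4 : η / 4 * s ^ 2 * (4 * L ^ 2 * N * η ^ 2 / B) ≤ η / 4 * s ^ 2 * 1 := by gcongr
    have e5 : 0 ≤ η / 4 * s ^ 2 * (4 * L ^ 2 * N * η ^ 2 / B) := by positivity
    nlinarith
  have h2 : 2 * L * (η * s) ^ 2 ≤ η / 4 * s ^ 2 := by
    have : 2 * L * (η * s) ^ 2 = η / 4 * s ^ 2 * (8 * L * η) := by ring
    rw [this]
    exact mul_le_of_le_one_right (by positivity) hL
  have h3 : 1 / N * ((c - V') + η * N / 2 * (σ ^ 2 / N)) +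
      (1 - 1 / N) * ((c - V') + η * N / 2 * (e ^ 2 + 2 * L ^ 2 * (η * s) ^ 2 / B)) =
      c - V' + η / 2 * (σ ^ 2 / N) + η * N / 2 * e ^ 2 - η / 2 * e ^ 2 +
      (1 - 1 / N) * (η * N / 2 * (2 * L ^ 2 * (η * s) ^ 2 / B)) := by
    field_simp
    ring
  rw [h3]
  -- A reset of weight `1 / N` removes `η/2 e²`. Polarization turns this into `η/2 s²`, which pays
  -- the two costs, `η/2 k²`, the desired gain, and `-η i`, which cancels the first-order term.
  have h4 : η / 2 * e ^ 2 = η / 2 * s ^ 2 + η / 2 * k ^ 2 - η * i := by rw [hi]; ring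
  linarith

/-- Expected progress of one iteration of PAGE-PG. -/
theorem lintegral_lyapunov_pageStep_le (m : EpisodicMDP S A) (hs : π.SmoothPolicy M)
    (hG : π.BoundedScore G) (hG0 : 0 < G) (hM0 : 0 < M) (hvar : m.FiniteVariance π σ)
    {I : PageInput d} (hI : GoodInput m I G M) (x : PageState d) :
    ∫⁻ y, ENNReal.ofReal (m.lyapunov π (I.η * I.N / 2) (1 / (8 * m.H * G) / I.η) y)
        ∂(m.pageStep π I x) + ENNReal.ofReal (I.η / 2 * ‖gradient (m.value π) x.1‖ ^ 2) ≤
      ENNReal.ofReal (m.lyapunov π (I.η * I.N / 2) (1 / (8 * m.H * G) / I.η) x) +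
        ENNReal.ofReal (I.η / 2 * (σ ^ 2 / I.N)) := by
  have hη := hI.η_pos
  have hHpos : (0 : ℝ) < m.H := by exact_mod_cast m.H_pos
  have hN1 : (1 : ℝ) ≤ I.N := by exact_mod_cast Nat.one_le_iff_ne_zero.2 hI.N_ne_zero
  have hN0 : (0 : ℝ) < I.N := by linarith
  have hB0 : (0 : ℝ) < I.B := by exact_mod_cast Nat.pos_of_ne_zero hI.B_ne_zero
  have hp1 : 0 ≤ 1 - I.p := sub_nonneg.2 hI.p_le_one
  obtain ⟨θ, v, n⟩ := x
  set a := 1 / (8 * m.H * G) / I.η with ha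
  set b := I.η * I.N / 2 with hb
  have hb0 : 0 ≤ b := by positivity
  have ha0 : 0 ≤ a := by positivity
  set θ' := θ + I.η • v with hθ'
  set k := gradient (m.value π) θ with hk
  have hgap : ∀ ϑ, 0 ≤ m.H * m.R - m.value π ϑ := fun ϑ =>
    sub_nonneg.2 ((le_abs_self _).trans (m.abs_value_le π ϑ))
  have hgap' : ∀ ϑ, -(m.H * m.R) ≤ m.value π ϑ := fun ϑ => (abs_le.1 (m.abs_value_le π ϑ)).1
  have hk1 : ‖k‖ ≤ m.H * (m.H * (m.R * G)) := m.norm_gradient_value_le hs hG hG0.le θ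
  rw [m.lintegral_pageStep hs I _ (m.measurable_lyapunov hs hG hG0.le b a)]
  simp only [lyapunov]
  have hlarge : ∫⁻ τ, ENNReal.ofReal ((m.H * m.R - m.value π θ') + b *
      min (‖(I.N : ℝ)⁻¹ • ∑ i, m.gpomdp π θ' (τ i) - gradient (m.value π) θ'‖ ^ 2) (a ^ 2))
        ∂(Measure.pi fun _ : Fin I.N => m.trajLaw π θ') ≤
      ENNReal.ofReal ((m.H * m.R - m.value π θ') + b * (σ ^ 2 / I.N)) := by
    have hmean := m.norm_mean_gpomdp_sub_sq_le hs hG hG0.le hvar θ' hI.N_ne_zero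
    exact lintegral_ofReal_add_mul_min_le hmean.1 (fun _ => by positivity) (hgap _) hb0 hmean.2
  have hcombine : ∀ X Y Z W : ℝ, 0 ≤ X → 0 ≤ Y → 0 ≤ Z → 0 ≤ W →
      I.p * X + (1 - I.p) * Y + I.η / 2 * ‖k‖ ^ 2 ≤ Z + W →
      ENNReal.ofReal I.p * ENNReal.ofReal X + ENNReal.ofReal (1 - I.p) * ENNReal.ofReal Y +
        ENNReal.ofReal (I.η / 2 * ‖k‖ ^ 2) ≤ ENNReal.ofReal Z + ENNReal.ofReal W := by
    intro X Y Z W hX hY hZ hW h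
    have hp := hI.p_nonneg
    rw [← ENNReal.ofReal_mul hp, ← ENNReal.ofReal_mul hp1,
      ← ENNReal.ofReal_add (by positivity) (by positivity),
      ← ENNReal.ofReal_add (by positivity) (by positivity), ← ENNReal.ofReal_add hZ hW]
    exact ENNReal.ofReal_le_ofReal h
  -- Below the cap the step is short and the weights are controlled; at or above it only the cap and
  -- the boundedness of the value are used.
  rcases lt_or_ge ‖v - k‖ a with hsmall | hbig
  · have hv : ‖I.η • v‖ ≤ 1 / (4 * m.H * G) := by
      rw [norm_smul, Real.norm_of_nonneg hη.le]
      have h1 : ‖v‖ ≤ a + ‖k‖ := by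
        calc ‖v‖ = ‖(v - k) + k‖ := by rw [sub_add_cancel]
          _ ≤ _ := (norm_add_le _ _).trans (by linarith)
      have h2 : I.η * a = 1 / (8 * m.H * G) := by rw [ha]; field_simp
      have h3 := hI.short
      -- One half of the allowed step length covers the error, the other half covers the gradient.
      have h4 : 1 / (4 * m.H * G) = 1 / (8 * m.H * G) + 1 / (8 * m.H * G) := by
        field_simp
        norm_num
      calc I.η * ‖v‖ ≤ I.η * (a + m.H * (m.H * (m.R * G))) := by gcongr; linarith
        _ ≤ _ := by rw [h4]; linarith
    have hθv : ‖θ - θ'‖ = I.η * ‖v‖ := by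
      rw [hθ', sub_add_cancel_left, norm_neg, norm_smul, Real.norm_of_nonneg hη.le]
    have hcorr : ∫⁻ τ, ENNReal.ofReal ((m.H * m.R - m.value π θ') + b *
        min (‖(I.B : ℝ)⁻¹ • ∑ i, m.gpomdp π θ' (τ i) + v
          - (I.B : ℝ)⁻¹ • ∑ i, m.gpomdpOff π θ' θ (τ i) - gradient (m.value π) θ'‖ ^ 2) (a ^ 2))
        ∂(Measure.pi fun _ : Fin I.B => m.trajLaw π θ') ≤
        ENNReal.ofReal ((m.H * m.R - m.value π θ') + b * (‖v - k‖ ^ 2 +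
          2 * m.constL G M ^ 2 * (I.η * ‖v‖) ^ 2 / I.B)) := by
      have hθ'' : ‖θ - θ'‖ ≤ 1 / (4 * m.H * G) := by
        rw [hθv]
        rwa [norm_smul, Real.norm_of_nonneg hη.le] at hv
      have hmean := m.norm_correction_sub_sq_le hs hG hG0 hM0 θ θ' v hθ'' hI.B_ne_zero
      rw [hθv] at hmean
      exact lintegral_ofReal_add_mul_min_le hmean.1 (fun _ => by positivity) (hgap _) hb0 hmean.2
    refine le_trans (add_le_add_left (add_le_add (mul_le_mul_right hlarge _)
      (mul_le_mul_right hcorr _)) _) ?_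
    have hg := hgap θ
    have hg' := hgap θ'
    refine hcombine _ _ _ _ (by positivity) (by positivity) (by positivity) (by positivity) ?_
    have hmin : min (‖v - k‖ ^ 2) (a ^ 2) = ‖v - k‖ ^ 2 :=
      min_eq_left (pow_le_pow_left₀ (norm_nonneg _) hsmall.le 2)
    rw [hmin, hI.p_eq]
    have hdesc := m.value_sub_le_inner hs hG hG0 hM0 θ (I.η • v) hv
    rw [inner_smul_right, norm_smul, Real.norm_of_nonneg hη.le] at hdesc
    refine descent_inequality (i := inner ℝ k v) hη hN1 hB0 hI.smooth hI.batch ?_ hdesc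
    rw [norm_sub_sq_real, real_inner_comm]
    ring
  · have hcorr : ∫⁻ τ, ENNReal.ofReal ((m.H * m.R - m.value π θ') + b *
        min (‖(I.B : ℝ)⁻¹ • ∑ i, m.gpomdp π θ' (τ i) + v
          - (I.B : ℝ)⁻¹ • ∑ i, m.gpomdpOff π θ' θ (τ i) - gradient (m.value π) θ'‖ ^ 2) (a ^ 2))
        ∂(Measure.pi fun _ : Fin I.B => m.trajLaw π θ') ≤
        ENNReal.ofReal ((m.H * m.R - m.value π θ') + b * a ^ 2) := by
      refine (lintegral_mono (g := fun _ => ENNReal.ofReal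
        ((m.H * m.R - m.value π θ') + b * a ^ 2)) fun τ => ENNReal.ofReal_le_ofReal ?_).trans
          (by simp)
      gcongr
      exact min_le_right _ _
    refine le_trans (add_le_add_left (add_le_add (mul_le_mul_right hlarge _)
      (mul_le_mul_right hcorr _)) _) ?_
    have hg := hgap θ
    have hg' := hgap θ'
    refine hcombine _ _ _ _ (by positivity) (by positivity) (by positivity) (by positivity) ?_
    have hmin : min (‖v - k‖ ^ 2) (a ^ 2) = a ^ 2 :=
      min_eq_right (pow_le_pow_left₀ ha0 hbig 2)
    rw [hmin, hI.p_eq]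
    have h1 : I.η / 2 * ‖k‖ ^ 2 ≤ I.η / 2 * (m.H * (m.H * (m.R * G))) ^ 2 := by gcongr
    have h2 := hI.escape
    -- The chance `1 / N` of a reset, times the weight `η N / 2`, removes `η/2 a²` from the
    -- potential; `escape` says that this exceeds all possible losses.
    have h3 : 1 / (I.N : ℝ) * ((m.H * m.R - m.value π θ') + b * (σ ^ 2 / I.N)) +
        (1 - 1 / (I.N : ℝ)) * ((m.H * m.R - m.value π θ') + b * a ^ 2) =
        (m.H * m.R - m.value π θ') + I.η / 2 * (σ ^ 2 / I.N) + b * a ^ 2 - I.η / 2 * a ^ 2 := by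
      rw [hb]
      field_simp
      ring
    rw [h3]
    linarith [hgap' θ', hgap' θ, (abs_le.1 (m.abs_value_le π θ)).2]

theorem lintegral_lyapunov_pageInit_le (m : EpisodicMDP S A) (hs : π.SmoothPolicy M)
    (hG : π.BoundedScore G) (hG0 : 0 ≤ G) (hvar : m.FiniteVariance π σ)
    {I : PageInput d} (hN : I.N ≠ 0) (hη : 0 ≤ I.η) (a : ℝ) :
    ∫⁻ y, ENNReal.ofReal (m.lyapunov π (I.η * I.N / 2) a y) ∂(m.pageInit π I) ≤
      ENNReal.ofReal (2 * (m.H * m.R) + I.η / 2 * σ ^ 2) := by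
  have hN0 : (0 : ℝ) < I.N := by exact_mod_cast Nat.pos_of_ne_zero hN
  rw [pageInit, lintegral_map (m.measurable_lyapunov hs hG hG0 _ a) (m.measurable_pageInit hs I)]
  have hv := abs_le.1 (m.abs_value_le π I.θ₀)
  have hmean := m.norm_mean_gpomdp_sub_sq_le hs hG hG0 hvar I.θ₀ hN
  refine (lintegral_ofReal_add_mul_min_le hmean.1 (fun _ => by positivity) (sub_nonneg.2 hv.2)
    (by positivity) hmean.2).trans (ENNReal.ofReal_le_ofReal ?_)
  have : I.η * I.N / 2 * (σ ^ 2 / I.N) = I.η / 2 * σ ^ 2 := by field_simp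
  rw [this]
  linarith

/-- Telescoping of the one-step estimate; the final potential is nonnegative and is dropped. -/
theorem sum_integral_norm_gradient_sq_le (m : EpisodicMDP S A) (hs : π.SmoothPolicy M)
    (hG : π.BoundedScore G) (hG0 : 0 < G) (hM0 : 0 < M) (hvar : m.FiniteVariance π σ)
    {I : PageInput d} (hI : GoodInput m I G M) (T : ℕ) :
    I.η / 2 * ∑ t ∈ Finset.range T,
      ∫ x, ‖gradient (m.value π) x.1‖ ^ 2 ∂(m.pageLaw π I t) ≤
        2 * (m.H * m.R) + I.η / 2 * σ ^ 2 + T * (I.η / 2 * (σ ^ 2 / I.N)) := by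
  have hη := hI.η_pos
  have hR := m.R_pos.le
  set a := 1 / (8 * m.H * G) / I.η
  set Λ : PageState d → ENNReal := fun y => ENNReal.ofReal (m.lyapunov π (I.η * I.N / 2) a y)
  have hΛ : Measurable Λ := m.measurable_lyapunov hs hG hG0.le _ a
  set q := I.η / 2 * (σ ^ 2 / I.N) with hq
  have hq0 : 0 ≤ q := by positivity
  set g : ℕ → ℝ := fun t =>
    I.η / 2 * ∫ x, ‖gradient (m.value π) x.1‖ ^ 2 ∂(m.pageLaw π I t) with hg
  have hg0 : ∀ t, 0 ≤ g t := fun t =>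
    mul_nonneg (by positivity) (integral_nonneg fun x => by positivity)
  have hstep : ∀ t, ∫⁻ y, Λ y ∂(m.pageLaw π I (t + 1)) + ENNReal.ofReal (g t) ≤
      ∫⁻ y, Λ y ∂(m.pageLaw π I t) + ENNReal.ofReal q := by
    intro t
    have := m.isProbabilityMeasure_pageLaw hs I hI.p_nonneg hI.p_le_one t
    have hint := m.integrable_norm_gradient_sq_pageLaw hs hG hG0.le I hI.p_nonneg hI.p_le_one t
    have hmeas : Measurable fun x : PageState d =>
        ENNReal.ofReal (I.η / 2 * ‖gradient (m.value π) x.1‖ ^ 2) :=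
      ((((m.measurable_gradient_value π).comp measurable_fst).norm.pow_const 2).const_mul
        _).ennreal_ofReal
    rw [hg]
    simp only
    rw [← integral_const_mul, ofReal_integral_eq_lintegral_ofReal (hint.const_mul _)
      (ae_of_all _ fun x => by positivity), m.lintegral_pageLaw_succ hs I t hΛ,
      ← lintegral_add_right _ hmeas]
    calc _ ≤ ∫⁻ x, (Λ x + ENNReal.ofReal q) ∂(m.pageLaw π I t) :=
          lintegral_mono fun x =>
            m.lintegral_lyapunov_pageStep_le hs hG hG0 hM0 hvar hI x
      _ = _ := by
          rw [lintegral_add_left hΛ]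
          simp
  have hsum : ∀ T : ℕ, ∫⁻ y, Λ y ∂(m.pageLaw π I T) +
      ENNReal.ofReal (∑ t ∈ Finset.range T, g t) ≤
        ENNReal.ofReal (2 * (m.H * m.R) + I.η / 2 * σ ^ 2 + T * q) := by
    intro T
    induction T with
    | zero =>
      simpa [Λ, pageLaw] using m.lintegral_lyapunov_pageInit_le hs hG hG0.le hvar hI.N_ne_zero hη.le a
    | succ T ih =>
      rw [Finset.sum_range_succ, ENNReal.ofReal_add (Finset.sum_nonneg fun t _ => hg0 t) (hg0 T)]
      calc _ = (∫⁻ y, Λ y ∂(m.pageLaw π I (T + 1)) + ENNReal.ofReal (g T)) +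
            ENNReal.ofReal (∑ t ∈ Finset.range T, g t) := by ring
        _ ≤ (∫⁻ y, Λ y ∂(m.pageLaw π I T) + ENNReal.ofReal q) +
            ENNReal.ofReal (∑ t ∈ Finset.range T, g t) := add_le_add_left (hstep T) _
        _ = (∫⁻ y, Λ y ∂(m.pageLaw π I T) + ENNReal.ofReal (∑ t ∈ Finset.range T, g t)) +
            ENNReal.ofReal q := by ring
        _ ≤ ENNReal.ofReal (2 * (m.H * m.R) + I.η / 2 * σ ^ 2 + T * q) + ENNReal.ofReal q := by
            gcongr
        _ = _ := by
            rw [← ENNReal.ofReal_add (by positivity) hq0]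
            push_cast
            ring_nf
  rw [Finset.mul_sum]
  have h := le_add_self.trans (hsum T)
  exact (ENNReal.ofReal_le_ofReal_iff (by positivity)).1 h

theorem pageAvgGradSq_le (m : EpisodicMDP S A) (hs : π.SmoothPolicy M)
    (hG : π.BoundedScore G) (hG0 : 0 < G) (hM0 : 0 < M) (hvar : m.FiniteVariance π σ)
    {I : PageInput d} (hI : GoodInput m I G M) {T : ℕ} (hT : T ≠ 0) :
    m.pageAvgGradSq π I T ≤
      σ ^ 2 / I.N + (4 * (m.H * m.R) / I.η + σ ^ 2) / T := by
  have hη := hI.η_pos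
  have hT0 : (0 : ℝ) < T := by exact_mod_cast Nat.pos_of_ne_zero hT
  have h := m.sum_integral_norm_gradient_sq_le hs hG hG0 hM0 hvar hI T
  rw [pageAvgGradSq, one_div_mul_eq_div, div_le_iff₀ hT0]
  refine le_of_mul_le_mul_left (h.trans (le_of_eq ?_)) (half_pos hη)
  have hN0 : (I.N : ℝ) ≠ 0 := by exact_mod_cast hI.N_ne_zero
  field_simp
  ring

end EpisodicMDP

end Lyapunov

/-! ### The tuned parameters -/

section Tuning

variable {d : ℕ} {S A : Type*} [MeasurableSpace S] [MeasurableSpace A]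

namespace EpisodicMDP

variable {G M W : ℝ}

/-- The share `2 L²` of `C` is what the `batch` condition asks of the step size. -/
theorem two_mul_sq_constL_le_constC (m : EpisodicMDP S A) (hM : 0 ≤ M) (hW : 0 ≤ W) :
    2 * m.constL G M ^ 2 ≤ m.constC G M W := by
  have := m.R_pos
  have := m.γ_pos
  have := sub_pos.2 m.γ_lt_one
  have : 0 ≤ m.constCω G M W := by
    rw [constCω]
    positivity
  rw [constC]
  linarith

theorem constC_pos (m : EpisodicMDP S A) (hG : 0 < G) (hM : 0 < M) (hW : 0 ≤ W) :
    0 < m.constC G M W :=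
  lt_of_lt_of_le (by have := m.constL_pos hG hM; positivity)
    (m.two_mul_sq_constL_le_constC hM.le hW)

theorem pageTunedInput_η_sq (m : EpisodicMDP S A) (hC : 0 ≤ m.constC G M W)
    (θ₀ : EuclideanSpace ℝ (Fin d)) (N B : ℕ) :
    (m.pageTunedInput G M W θ₀ N B).η ^ 2 = B / (2 * m.constC G M W * N) := by
  rw [pageTunedInput, div_pow, Real.sq_sqrt (by positivity), Real.sq_sqrt (by positivity)]

/-- The tuned step size tends to `0`. -/
theorem tendsto_pageTunedInput_η (m : EpisodicMDP S A) (hC : 0 < m.constC G M W)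
    (θ₀ : EuclideanSpace ℝ (Fin d)) {N B : ℝ → ℕ} {κ : ℝ} (hκ : 0 < κ)
    (hN : ∀ᶠ ε in 𝓝[>] (0 : ℝ), κ * ε ^ (-2 : ℤ) ≤ (N ε : ℝ))
    (hB : (fun ε => (B ε : ℝ)) =O[𝓝[>] 0] fun _ => (1 : ℝ)) :
    Tendsto (fun ε => (m.pageTunedInput G M W θ₀ (N ε) (B ε)).η) (𝓝[>] 0) (𝓝 0) := by
  obtain ⟨b, hb⟩ := hB.bound
  have hsq : Tendsto (fun ε => (m.pageTunedInput G M W θ₀ (N ε) (B ε)).η ^ 2)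
      (𝓝[>] 0) (𝓝 0) := by
    have hlim : Tendsto (fun ε : ℝ => b / (2 * m.constC G M W * κ) * ε ^ 2) (𝓝[>] 0) (𝓝 0) := by
      have : Tendsto (fun ε : ℝ => b / (2 * m.constC G M W * κ) * ε ^ 2) (𝓝 0)
          (𝓝 (b / (2 * m.constC G M W * κ) * 0 ^ 2)) :=
        (continuous_const.mul (continuous_pow 2)).tendsto 0
      rw [zero_pow two_ne_zero, mul_zero] at this
      exact this.mono_left nhdsWithin_le_nhds
    refine squeeze_zero' (Eventually.of_forall fun ε => sq_nonneg _) ?_ hlim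
    filter_upwards [hN, hb, self_mem_nhdsWithin] with ε hNε hbε hε
    have hε0 : (0 : ℝ) < ε := hε
    rw [pageTunedInput_η_sq m hC.le]
    have hBb : (B ε : ℝ) ≤ b := by simpa using hbε
    have hb0 : 0 ≤ b := (Nat.cast_nonneg _).trans hBb
    have e : ε ^ (-2 : ℤ) = (ε ^ 2)⁻¹ := by rw [zpow_neg]; norm_cast
    rw [e] at hNε
    calc (B ε : ℝ) / (2 * m.constC G M W * N ε) ≤
          b / (2 * m.constC G M W * (κ * (ε ^ 2)⁻¹)) := by gcongr
      _ = _ := by field_simp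
  have := hsq.sqrt
  simp only [Real.sqrt_zero] at this
  refine this.congr fun ε => Real.sqrt_sq ?_
  rw [pageTunedInput]
  positivity

/-- `smooth`, `short` and `escape` hold once `η` is small. `batch` does not rely on smallness: `N η²
= B / (2 C)`, so it reduces to `2 L² ≤ C`. -/
theorem eventually_goodInput_pageTunedInput (m : EpisodicMDP S A) (hG : 0 < G) (hM : 0 < M)
    (hW : 0 < W) (θ₀ : EuclideanSpace ℝ (Fin d)) {N B : ℝ → ℕ} {κ : ℝ} (hκ : 0 < κ)
    (hN : ∀ᶠ ε in 𝓝[>] (0 : ℝ), κ * ε ^ (-2 : ℤ) ≤ (N ε : ℝ))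
    (hB : (fun ε => (B ε : ℝ)) =O[𝓝[>] 0] fun _ => (1 : ℝ))
    (hB' : ∀ᶠ ε in 𝓝[>] (0 : ℝ), 1 ≤ B ε) :
    ∀ᶠ ε in 𝓝[>] (0 : ℝ), GoodInput m (m.pageTunedInput G M W θ₀ (N ε) (B ε)) G M := by
  have hC := m.constC_pos hG hM hW.le
  have hη := m.tendsto_pageTunedInput_η hC θ₀ hκ hN hB
  have hHpos : (0 : ℝ) < m.H := by exact_mod_cast m.H_pos
  set K : ℝ := m.H * (m.H * (m.R * G))
  set c : ℝ := 1 / (8 * m.H * G) with hc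
  have hc0 : 0 < c := by positivity
  have hlim : ∀ f : ℝ → ℝ, Continuous f → f 0 = 0 → ∀ u > 0,
      ∀ᶠ ε in 𝓝[>] (0 : ℝ), f ((m.pageTunedInput G M W θ₀ (N ε) (B ε)).η) < u := by
    intro f hf hf0 u hu
    exact (hf.tendsto' 0 0 hf0).comp hη |>.eventually_lt_const hu
  filter_upwards [hN, hB', self_mem_nhdsWithin,
    hlim (fun η => 8 * m.constL G M * η) (by fun_prop) (by simp) 1 one_pos,
    hlim (fun η => η * K) (by fun_prop) (by simp) c hc0,
    hlim (fun η => 2 * (m.H * m.R) * η + η ^ 2 / 2 * K ^ 2) (by fun_prop) (by simp) (c ^ 2 / 2)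
      (by positivity)] with ε hNε hBε hε h1 h2 h3
  have hε0 : (0 : ℝ) < ε := hε
  have hN0 : (0 : ℝ) < N ε := lt_of_lt_of_le (by positivity) hNε
  have hB0 : (0 : ℝ) < B ε := by exact_mod_cast hBε
  have hηpos : 0 < (m.pageTunedInput G M W θ₀ (N ε) (B ε)).η := by
    rw [pageTunedInput]
    positivity
  refine ⟨by exact_mod_cast hN0.ne', by exact_mod_cast hB0.ne', hηpos, rfl, h1.le, ?_, h2.le, ?_⟩
  · rw [m.pageTunedInput_η_sq hC.le]
    change 4 * m.constL G M ^ 2 * (N ε : ℝ) * ((B ε : ℝ) / (2 * m.constC G M W * N ε)) ≤ B ε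
    have e : 4 * m.constL G M ^ 2 * (N ε : ℝ) * ((B ε : ℝ) / (2 * m.constC G M W * N ε)) =
        B ε * (2 * m.constL G M ^ 2 / m.constC G M W) := by
      field_simp
      ring
    rw [e]
    exact mul_le_of_le_one_right hB0.le
      (div_le_one_of_le₀ (m.two_mul_sq_constL_le_constC hM.le hW.le) hC.le)
  · set η := (m.pageTunedInput G M W θ₀ (N ε) (B ε)).η
    -- Multiplied by `η`, the right side of `escape` becomes the constant `c² / 2`, while the left
    -- side tends to `0`.
    refine le_of_mul_le_mul_left ?_ hηpos
    have e1 : η * (η / 2 * (c / η) ^ 2) = c ^ 2 / 2 := by field_simp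
    rw [e1]
    linarith

/-- To be used with `x = ε⁻¹`: a batch size `N` of order `ε⁻²` makes `1 / η` of order `ε⁻¹`. -/
theorem inv_pageTunedInput_η_le (m : EpisodicMDP S A) (hC : 0 ≤ m.constC G M W)
    (θ₀ : EuclideanSpace ℝ (Fin d)) {N B : ℕ} (hB : 1 ≤ B) {c x : ℝ} (hx : 0 ≤ x)
    (hN : (N : ℝ) ≤ c * x ^ 2) :
    (m.pageTunedInput G M W θ₀ N B).η⁻¹ ≤ √(2 * m.constC G M W * c) * x := by
  have hB1 : 1 ≤ √(B : ℝ) := Real.one_le_sqrt.2 (by exact_mod_cast hB)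
  rw [pageTunedInput, inv_div]
  calc √(2 * m.constC G M W * N) / √(B : ℝ) ≤ √(2 * m.constC G M W * N) :=
        div_le_self (Real.sqrt_nonneg _) hB1
    _ ≤ √(2 * m.constC G M W * c * x ^ 2) := by
        refine Real.sqrt_le_sqrt ?_
        rw [mul_assoc _ c]
        gcongr
    _ = _ := by rw [Real.sqrt_mul' _ (sq_nonneg x), Real.sqrt_sq hx]

end EpisodicMDP

end Tuning

theorem corollary1 {d : ℕ} {S A : Type*} [MeasurableSpace S] [MeasurableSpace A]
    (ν : Measure A) [SigmaFinite ν] (m : EpisodicMDP S A) (π : PolicyFamily d S ν)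
    (G M σ W : ℝ) (hG : 0 < G) (hM : 0 < M) (hσ : 0 < σ) (hW : 0 < W)
    (hscore : π.BoundedScore G) (hsmooth : π.SmoothPolicy M)
    (hvar : m.FiniteVariance π σ) (hweight : m.FiniteWeightVariance π W)
    (θ₀ : EuclideanSpace ℝ (Fin d))
    (N B : ℝ → ℕ) (κ : ℝ) (hκ : σ ^ 2 < κ)
    (hN : (fun ε => (N ε : ℝ)) =O[𝓝[>] 0] fun ε => ε ^ (-2 : ℤ))
    (hN' : ∀ᶠ ε in 𝓝[>] (0 : ℝ), κ * ε ^ (-2 : ℤ) ≤ (N ε : ℝ))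
    (hB : (fun ε => (B ε : ℝ)) =O[𝓝[>] 0] fun _ => (1 : ℝ))
    (hB' : ∀ᶠ ε in 𝓝[>] (0 : ℝ), 1 ≤ B ε) :
    -- the objective is differentiable and the expectations below are genuine
    Differentiable ℝ (m.value π) ∧
    (∀ᶠ ε in 𝓝[>] (0 : ℝ), ∀ t,
      IsProbabilityMeasure (m.pageLaw π (m.pageTunedInput G M W θ₀ (N ε) (B ε)) t) ∧
      Integrable (fun x : PageState d => ‖gradient (m.value π) x.1‖ ^ 2)
        (m.pageLaw π (m.pageTunedInput G M W θ₀ (N ε) (B ε)) t) ∧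
      Integrable (fun x : PageState d => (x.2.2 : ℝ))
        (m.pageLaw π (m.pageTunedInput G M W θ₀ (N ε) (B ε)) t)) ∧
    -- the complexity bound
    ∃ T : ℝ → ℕ,
      (∀ᶠ ε in 𝓝[>] (0 : ℝ), 1 ≤ T ε ∧ ∀ T' ≥ T ε,
        m.pageAvgGradSq π (m.pageTunedInput G M W θ₀ (N ε) (B ε)) T' ≤ ε ^ 2) ∧
      (fun ε => m.pageExpectedTrajectories π (m.pageTunedInput G M W θ₀ (N ε) (B ε)) (T ε))
        =O[𝓝[>] 0] fun ε => ε ^ (-3 : ℤ) := by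
  have hκ0 : 0 < κ := lt_of_le_of_lt (sq_nonneg σ) hκ
  have hC := m.constC_pos hG hM hW.le
  have hgood := m.eventually_goodInput_pageTunedInput hG hM hW θ₀ hκ0 hN' hB hB'
  refine ⟨m.differentiable_value hsmooth hscore hG.le, ?_, ?_⟩
  · filter_upwards [hgood] with ε hI t
    exact ⟨m.isProbabilityMeasure_pageLaw hsmooth _ hI.p_nonneg hI.p_le_one t,
      m.integrable_norm_gradient_sq_pageLaw hsmooth hscore hG.le _ hI.p_nonneg hI.p_le_one t,
      m.integrable_count_pageLaw hsmooth _ hI.N_ne_zero hI.p_eq t⟩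
  obtain ⟨cN, hcN⟩ := hN.bound
  obtain ⟨b, hb⟩ := hB.bound
  -- The noise floor `σ² / N` uses the fraction `σ² / κ < 1` of `ε²`; the rest is left for the term
  -- decaying in `T`.
  have hρ : 0 < 1 - σ ^ 2 / κ := sub_pos.2 ((div_lt_one hκ0).2 hκ)
  set v := 4 * (m.H * m.R) * √(2 * m.constC G M W * cN) + σ ^ 2 with hv
  have hR := m.R_pos
  have hv0 : 0 < v := by positivity
  -- For small `ε` the numerator `4 H R / η + σ²` is at most `v ε⁻¹`; dividing by `T ≥ c ε⁻³` gives
  -- exactly the remaining fraction of `ε²`.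
  set c := v / (1 - σ ^ 2 / κ) with hc
  have hc0 : 0 < c := by positivity
  have hz2 : ∀ ε : ℝ, ε ^ (-2 : ℤ) = ε⁻¹ ^ 2 := fun ε => by rw [zpow_neg, inv_pow]; norm_cast
  have hz3 : ∀ ε : ℝ, ε ^ (-3 : ℤ) = ε⁻¹ ^ 3 := fun ε => by rw [zpow_neg, inv_pow]; norm_cast
  have hlt1 : ∀ᶠ ε in 𝓝[>] (0 : ℝ), ε < 1 :=
    nhdsWithin_le_nhds (Iio_mem_nhds (zero_lt_one : (0 : ℝ) < 1))
  -- The added one makes the requirement `1 ≤ T ε` immediate.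
  refine ⟨fun ε => ⌈c * ε⁻¹ ^ 3⌉₊ + 1, ?_, ?_⟩
  · filter_upwards [hgood, hN', hB', hcN, hlt1, self_mem_nhdsWithin]
      with ε hI hNε hBε hcNε hε1 hε
    have hε0 : (0 : ℝ) < ε := hε
    refine ⟨Nat.le_add_left _ _, fun T' hT' => ?_⟩
    have hx1 : 1 ≤ ε⁻¹ := (one_le_inv₀ hε0).2 hε1.le
    have hT : c * ε⁻¹ ^ 3 ≤ T' :=
      (Nat.le_ceil _).trans (by exact_mod_cast (Nat.le_succ _).trans hT')
    have hNle : (N ε : ℝ) ≤ cN * ε⁻¹ ^ 2 := by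
      rw [hz2] at hcNε
      simpa [abs_of_pos hε0] using hcNε
    rw [hz2] at hNε
    refine (m.pageAvgGradSq_le hsmooth hscore hG hM hvar hI (by omega)).trans ?_
    have hη := m.inv_pageTunedInput_η_le hC.le θ₀ hBε (by positivity) hNle
    have h1 : σ ^ 2 / (N ε : ℝ) ≤ σ ^ 2 / κ * ε ^ 2 := by
      calc σ ^ 2 / (N ε : ℝ) ≤ σ ^ 2 / (κ * ε⁻¹ ^ 2) := by gcongr
        _ = _ := by field_simp
    have h2 : 4 * (m.H * m.R) / (m.pageTunedInput G M W θ₀ (N ε) (B ε)).η + σ ^ 2 ≤ v * ε⁻¹ := by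
      rw [hv, add_mul, div_eq_mul_inv, mul_assoc (4 * (m.H * m.R))]
      gcongr
      exact le_mul_of_one_le_right (sq_nonneg σ) hx1
    have h3 : (4 * (m.H * m.R) / (m.pageTunedInput G M W θ₀ (N ε) (B ε)).η + σ ^ 2) / T' ≤
        (1 - σ ^ 2 / κ) * ε ^ 2 := by
      calc _ ≤ v * ε⁻¹ / (c * ε⁻¹ ^ 3) := by gcongr
        _ = _ := by
            rw [hc]
            field_simp
    change σ ^ 2 / (N ε : ℝ) + _ ≤ _
    linarith
  · refine IsBigO.of_bound (cN + (c + 2) * (1 + b)) ?_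
    filter_upwards [hgood, hcN, hb, hlt1, self_mem_nhdsWithin] with ε hI hcNε hbε hε1 hε
    have hε0 : (0 : ℝ) < ε := hε
    have hx1 : 1 ≤ ε⁻¹ := (one_le_inv₀ hε0).2 hε1.le
    have hNle : (N ε : ℝ) ≤ cN * ε⁻¹ ^ 2 := by
      rw [hz2] at hcNε
      simpa [abs_of_pos hε0] using hcNε
    have hcN0 : 0 ≤ cN := by
      by_contra! h
      have : cN * ε⁻¹ ^ 2 < 0 := mul_neg_of_neg_of_pos h (by positivity)
      linarith [Nat.cast_nonneg (α := ℝ) (N ε)]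
    have hBb : (B ε : ℝ) ≤ b := by simpa using hbε
    have hb0 : 0 ≤ b := (Nat.cast_nonneg _).trans hBb
    have hT : ((⌈c * ε⁻¹ ^ 3⌉₊ + 1 : ℕ) : ℝ) ≤ (c + 2) * ε⁻¹ ^ 3 := by
      have h1 := (Nat.ceil_lt_add_one (by positivity : 0 ≤ c * ε⁻¹ ^ 3)).le
      have h2 : 1 ≤ ε⁻¹ ^ 3 := one_le_pow₀ hx1
      push_cast
      linarith
    have hnn : 0 ≤ m.pageExpectedTrajectories π (m.pageTunedInput G M W θ₀ (N ε) (B ε))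
        (⌈c * ε⁻¹ ^ 3⌉₊ + 1) := integral_nonneg fun x => Nat.cast_nonneg _
    rw [Real.norm_of_nonneg hnn, Real.norm_of_nonneg (by positivity), hz3]
    refine (m.pageExpectedTrajectories_le hsmooth _ hI.N_ne_zero hI.p_eq _).trans ?_
    change (N ε : ℝ) + _ * (1 + (B ε : ℝ)) ≤ _
    calc _ ≤ cN * ε⁻¹ ^ 3 + (c + 2) * ε⁻¹ ^ 3 * (1 + b) := by
          gcongr
          refine hNle.trans ?_
          gcongr
          · norm_num
      _ = _ := by ring
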